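/- Let $\omega>0$, let $k\ge 0$ be an integer and let $\lambda>k$. For $\vec x,\vec y,\vec x',\vec y'\in\mathbb R^3$ put $$G^\lambda_\omega(\vec x,\vec y;\vec x',\vec y')=\frac{\omega^{2}}{2^{3/2}\pi^{3}}\int_0^1 d\nu\,\frac{\nu^{\lambda/\omega-1}}{(1-\nu^2)^{3/2}\left(\ln\frac1\nu\right)^{3/2}}\exp\left\{-\frac{\omega}{2}\,\frac{1-\nu}{1+\nu}\left(y^2+y'^2\right)-\frac{\omega}{2\ln\frac1\nu}(\vec x-\vec x')^2-\frac{\omega\nu}{1-\nu^2}(\vec y-\vec y')^2\right\},$$ the Green function (resolvent kernel at $-\lambda$) of $-\frac12\Delta_{\vec x}-\frac12\Delta_{\vec y}+\frac{\omega^2y^2}{2}-\frac{3\omega}{2}$. Then this kernel defines a bounded integral operator $G^\lambda_\omega$ on $L^2(\mathbb R^6)$, the formula $$\mathcal G^\lambda_\omega f(\vec x,\vec y)=\int_{\mathbb R^3}G^\lambda_\omega(\vec x,\vec y;\vec x',\vec x')\,f(\vec x')\,d\vec x'$$ defines a bounded operator $\mathcal G^\lambda_\omega:L^2(\mathbb R^3)\to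 L^2(\mathbb R^6)$, and for every real $p>\dfrac{3}{k+1/2}$ the operator $$T^k_\omega=(\mathcal G^\lambda_\omega)^*\,(G^\lambda_\omega)^k\,\mathcal G^\lambda_\omega:L^2(\mathbb R^3)\to L^2(\mathbb R^3)$$ belongs to the Schatten class $\mathscr B_p(L^2(\mathbb R^3))$, that is, it is compact and its singular values $\mu_0\ge\mu_1\ge\dots\ge0$ (repeated according to multiplicity) satisfy $\sum_n\mu_n^p<\infty$. -/

import Mathlib

open MeasureTheory

noncomputable section

namespace ZeroRange

/-- The configuration space `ℝ³` of one particle, with its Euclidean norm. -/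
abbrev R3 : Type := EuclideanSpace ℝ (Fin 3)

/-- `L²(ℝ³)`. -/
abbrev L2R3 : Type := Lp ℂ 2 (volume : Measure R3)

/-- `L²(ℝ⁶)`, a point of `ℝ⁶` being a pair `(x, y)` of points of `ℝ³`. -/
abbrev L2R6 : Type := Lp ℂ 2 (volume : Measure (R3 × R3))

/-- The Green function `G_ω^λ(x, y; x', y')` in dimension three, that is, the integral kernel of
`(H₀ + λ)⁻¹` for `H₀ = -Δ_x / 2 - Δ_y / 2 + ω² |y|² / 2 - 3 ω / 2`. The first point is `(x, y)`,
the second one is `(x', y')`. The integral converges absolutely when the two points differ. -/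
def greenKernel (ω lam : ℝ) (X X' : R3 × R3) : ℝ :=
  ω ^ 2 / ((2 : ℝ) ^ (3 / 2 : ℝ) * Real.pi ^ 3) *
    ∫ ν in Set.Ioo (0 : ℝ) 1,
      ν ^ (lam / ω - 1) / ((1 - ν ^ 2) ^ (3 / 2 : ℝ) * Real.log (1 / ν) ^ (3 / 2 : ℝ)) *
        Real.exp
          (-(ω / 2 * ((1 - ν) / (1 + ν)) * (‖X.2‖ ^ 2 + ‖X'.2‖ ^ 2))
            - ω / (2 * Real.log (1 / ν)) * ‖X.1 - X'.1‖ ^ 2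
            - ω * ν / (1 - ν ^ 2) * ‖X.2 - X'.2‖ ^ 2)

/-- The kernel `G_ω^λ(x, y; x', x')` of the potential of a charge carried by the plane `x = y`. -/
def potentialKernel (ω lam : ℝ) (X : R3 × R3) (x' : R3) : ℝ :=
  greenKernel ω lam X (x', x')

/-- The bounded operator `T` is the integral operator with kernel `K`: for every `f` in `L²` one has
`(T f)(y) = ∫ K(y, x) f(x) dx` for almost every `y`, with an absolutely convergent integral. -/
def IsIntegralOperator {X Y : Type*} [MeasurableSpace X] [MeasurableSpace Y]
    {μ : Measure X} {ν : Measure Y} (T : Lp ℂ 2 μ →L[ℂ] Lp ℂ 2 ν) (K : Y → X → ℝ) : Prop :=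
  ∀ f : Lp ℂ 2 μ,
    (∀ᵐ y ∂ν, Integrable (fun x => (K y x : ℂ) * f x) μ) ∧
      ∀ᵐ y ∂ν, T f y = ∫ x, (K y x : ℂ) * f x ∂μ

/-- There is at most one integral operator with a given kernel. -/
theorem IsIntegralOperator.unique {X Y : Type*} [MeasurableSpace X] [MeasurableSpace Y]
    {μ : Measure X} {ν : Measure Y} {T S : Lp ℂ 2 μ →L[ℂ] Lp ℂ 2 ν} {K : Y → X → ℝ}
    (hT : IsIntegralOperator T K) (hS : IsIntegralOperator S K) : T = S := by
  ext1 f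
  apply Lp.ext
  filter_upwards [(hT f).2, (hS f).2] with y h1 h2
  rw [h1, h2]

section Schatten

variable {H H' : Type*} [NormedAddCommGroup H] [InnerProductSpace ℂ H] [CompleteSpace H]
  [NormedAddCommGroup H'] [InnerProductSpace ℂ H'] [CompleteSpace H']

/-- The eigenspace of `A* A` for the eigenvalue `t²`. For `t > 0` it is nonzero exactly when `t` is a
singular value of `A`, and its dimension is then the multiplicity of `t`. -/
def singularSpace (A : H →L[ℂ] H') (t : ℝ) : Submodule ℂ H :=
  Module.End.eigenspace ((A.adjoint ∘L A : H →L[ℂ] H) : H →ₗ[ℂ] H) ((t : ℂ) ^ 2)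

/-- The singular values `μ₀ ≥ μ₁ ≥ …` of a compact operator `A`, in decreasing order and repeated
according to multiplicity: `μₙ` is the least `s ≥ 0` such that at most `n` singular values,
counted with multiplicity, are greater than `s`. -/
def singularValue (A : H →L[ℂ] H') (n : ℕ) : ℝ :=
  sInf {s : ℝ | 0 ≤ s ∧ Module.rank ℂ ↥(⨆ t : Set.Ioi s, singularSpace A t) ≤ (n : Cardinal)}

/-- Membership in the Schatten class `𝓑_p(H, H')` for a finite exponent `p > 0`: the operator is
compact and its singular values are `p`-summable. -/
def IsSchatten (p : ℝ) (A : H →L[ℂ] H') : Prop :=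
  IsCompactOperator A ∧ Summable fun n : ℕ => singularValue A n ^ p

end Schatten

end ZeroRange

end

/-!
Let `H₀` be the Hamiltonian of frequency `ω` without its point interaction. Then `G` is the Laplace
transform of the semigroup `exp (-t H₀)`, whose kernel is a heat kernel times a Mehler kernel, and
`P` is the Laplace transform of the operators `E_t` obtained by restricting one argument of that
kernel to the plane `x = y`. The kernel of `E_t* E_t` on `ℝ³` is a single Gaussian, and for `t ≤ 1`
it is dominated, up to the factor `t ^ (-3/2)`, by a Mehler kernel of frequency `2 ω` at a time
comparable to `t`. Mehler semigroups are Hilbert–Schmidt with an explicit norm, so off a subspace of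
dimension `O(r ^ 3)` the operators `E_t` decay like `t ^ (-3/4) * exp (-c r t)`. Integrating in time
gives `‖P f‖ = O(r ^ (-1/4)) ‖f‖` and `‖G ^ k (P f)‖ = O(r ^ (-k - 1/4)) ‖f‖` there, hence the form
of `P* G ^ k P` is `O(r ^ (-(k + 1/2)))` off a subspace of dimension `O(r ^ 3)`, and the singular
values are `O(n ^ (-(k + 1/2) / 3))`.
-/

noncomputable section

namespace ZeroRange

open scoped ENNReal InnerProductSpace

section FiniteCodimension

variable {𝕜 H H' : Type*} [RCLike 𝕜] [NormedAddCommGroup H] [InnerProductSpace 𝕜 H]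
  [NormedAddCommGroup H'] [InnerProductSpace 𝕜 H']

theorem norm_le_of_forall_norm_inner_le {v : H} {c : ℝ} (hc : 0 ≤ c)
    (h : ∀ u : H, ‖⟪u, v⟫_𝕜‖ ≤ c * ‖u‖) : ‖v‖ ≤ c := by
  rw [← innerSL_apply_norm 𝕜 v]
  refine ContinuousLinearMap.opNorm_le_bound _ hc fun u => ?_
  rw [innerSL_apply_apply, norm_inner_symm]
  exact h u

theorem norm_sub_starProjection_apply_le (V : Submodule 𝕜 H) [V.HasOrthogonalProjection] (f : H) :
    ‖f - V.starProjection f‖ ≤ ‖f‖ := by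
  rw [← Submodule.starProjection_orthogonal_val]
  exact Submodule.norm_starProjection_apply_le _ f

theorem isCompactOperator_comp_starProjection (A : H →L[𝕜] H') (V : Submodule 𝕜 H)
    [FiniteDimensional 𝕜 V] : IsCompactOperator (A ∘L V.starProjection) :=
  ((isCompactOperator_id_iff_finiteDimensional.2 ‹_› : IsCompactOperator (id : V → V)).clm_comp
    (A ∘L V.subtypeL)).comp_clm V.orthogonalProjectionOnto

theorem isCompactOperator_of_forall_norm_sub_le [CompleteSpace H'] {A : H →L[𝕜] H'}
    (h : ∀ ε > 0, ∃ B : H →L[𝕜] H', IsCompactOperator B ∧ ‖A - B‖ ≤ ε) :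
    IsCompactOperator A := by
  refine isClosed_setOfPred_isCompactOperator.closure_subset (Metric.mem_closure_iff.2 ?_)
  intro ε hε
  obtain ⟨B, hB, hAB⟩ := h (ε / 2) (by positivity)
  exact ⟨B, hB, by rw [dist_eq_norm]; linarith⟩

theorem norm_sub_starProjection_comp_le_of_form_le {T : H →L[𝕜] H'} {V : Submodule 𝕜 H}
    [V.HasOrthogonalProjection] {V' : Submodule 𝕜 H'} [V'.HasOrthogonalProjection] {ε : ℝ}
    (hε : 0 ≤ ε) (h : ∀ u ∈ V'ᗮ, ∀ f ∈ Vᗮ, ‖⟪u, T f⟫_𝕜‖ ≤ ε * (‖u‖ * ‖f‖))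
    {f : H} (hf : f ∈ Vᗮ) : ‖T f - V'.starProjection (T f)‖ ≤ ε * ‖f‖ := by
  rw [← Submodule.starProjection_orthogonal_val]
  refine norm_le_of_forall_norm_inner_le (𝕜 := 𝕜) (by positivity) fun u => ?_
  rw [← Submodule.inner_starProjection_left_eq_right]
  calc ‖⟪V'ᗮ.starProjection u, T f⟫_𝕜‖ ≤ ε * (‖V'ᗮ.starProjection u‖ * ‖f‖) :=
        h _ (V'ᗮ.starProjection_apply_mem u) f hf
    _ ≤ ε * (‖u‖ * ‖f‖) := by gcongr; exact Submodule.norm_starProjection_apply_le _ u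
    _ = ε * ‖f‖ * ‖u‖ := by ring

theorem isCompactOperator_of_form_le [CompleteSpace H'] {T : H →L[𝕜] H'}
    (h : ∀ ε > 0, ∃ (V : Submodule 𝕜 H) (V' : Submodule 𝕜 H'),
      FiniteDimensional 𝕜 V ∧ FiniteDimensional 𝕜 V' ∧
      ∀ u ∈ V'ᗮ, ∀ f ∈ Vᗮ, ‖⟪u, T f⟫_𝕜‖ ≤ ε * (‖u‖ * ‖f‖)) : IsCompactOperator T := by
  refine isCompactOperator_of_forall_norm_sub_le fun ε hε => ?_
  obtain ⟨V, V', _, _, hform⟩ := h ε hε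
  set Q := V.starProjection
  set Q' := V'.starProjection
  refine ⟨T ∘L Q + Q' ∘L (T - T ∘L Q), ?_, ?_⟩
  · have hQ' : IsCompactOperator ((1 : H' →L[𝕜] H') ∘L Q') :=
      isCompactOperator_comp_starProjection 1 V'
    exact (isCompactOperator_comp_starProjection T V).add (hQ'.comp_clm (T - T ∘L Q))
  · refine ContinuousLinearMap.opNorm_le_bound _ hε.le fun f => ?_
    have hcompress : (T - (T ∘L Q + Q' ∘L (T - T ∘L Q))) f = T (f - Q f) - Q' (T (f - Q f)) := by
      simp only [sub_apply, add_apply, ContinuousLinearMap.comp_apply, map_sub]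
      abel
    rw [hcompress]
    refine (norm_sub_starProjection_comp_le_of_form_le hε.le hform
      (V.sub_starProjection_mem_orthogonal f)).trans ?_
    gcongr
    exact norm_sub_starProjection_apply_le V f

end FiniteCodimension

section HilbertSchmidt

variable {𝕜 H H' : Type*} [RCLike 𝕜] [NormedAddCommGroup H] [InnerProductSpace 𝕜 H]
  [NormedAddCommGroup H'] [InnerProductSpace 𝕜 H']

/-- The square of the Hilbert–Schmidt norm of `A` is at most `C`. Mathlib has no Hilbert–Schmidt
operators; finite orthonormal families avoid choosing an orthonormal basis. -/
def HilbertSchmidtBound (A : H →L[𝕜] H') (C : ℝ) : Prop :=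
  ∀ (n : ℕ) (v : Fin n → H), Orthonormal 𝕜 v → ∑ i, ‖A (v i)‖ ^ 2 ≤ C

theorem orthonormal_finCons {n : ℕ} {v : Fin n → H} (hv : Orthonormal 𝕜 v) {f : H}
    (hf : ‖f‖ = 1) (hvf : ∀ i, ⟪v i, f⟫_𝕜 = 0) :
    Orthonormal 𝕜 (Fin.cons f v : Fin (n + 1) → H) := by
  rw [orthonormal_iff_ite] at hv ⊢
  intro i j
  refine Fin.cases ?_ (fun i => ?_) i <;> refine Fin.cases ?_ (fun j => ?_) j
  · simp [hf]
  · simp [← inner_conj_symm f, hvf, (Fin.succ_ne_zero j).symm]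
  · simp [hvf]
  · simp [hv]

theorem norm_apply_le_of_forall_norm_eq_one {A : H →L[𝕜] H'} {V : Submodule 𝕜 H} {ε : ℝ}
    (h : ∀ f ∈ V, ‖f‖ = 1 → ‖A f‖ ≤ ε) {f : H} (hf : f ∈ V) : ‖A f‖ ≤ ε * ‖f‖ := by
  rcases eq_or_ne f 0 with rfl | hf0
  · simp
  have hunit := h (((‖f‖ : 𝕜))⁻¹ • f) (V.smul_mem _ hf) (norm_smul_inv_norm hf0)
  rwa [map_smul, norm_smul, norm_inv, RCLike.norm_ofReal, abs_norm,
    inv_mul_le_iff₀ (norm_pos_iff.2 hf0), mul_comm] at hunit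

/- A finite orthonormal family whose sum of squares is within `ε²` of the supremum leaves at most
`ε²` for any further unit vector. -/
theorem HilbertSchmidtBound.exists_norm_apply_le {A : H →L[𝕜] H'} {C : ℝ}
    (hA : HilbertSchmidtBound A C) {ε : ℝ} (hε : 0 < ε) :
    ∃ V : Submodule 𝕜 H, FiniteDimensional 𝕜 V ∧ ∀ f ∈ Vᗮ, ‖A f‖ ≤ ε * ‖f‖ := by
  set sums : Set ℝ := {s | ∃ (n : ℕ) (v : Fin n → H), Orthonormal 𝕜 v ∧ s = ∑ i, ‖A (v i)‖ ^ 2}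
  have hbdd : BddAbove sums := ⟨C, by rintro s ⟨n, v, hv, rfl⟩; exact hA n v hv⟩
  have hne : sums.Nonempty := ⟨0, 0, Fin.elim0, ⟨fun i => i.elim0, fun i => i.elim0⟩, by simp⟩
  obtain ⟨s, ⟨n, v, hv, rfl⟩, hs⟩ := exists_lt_of_lt_csSup hne
    (show sSup sums - ε ^ 2 < sSup sums by linarith [pow_pos hε 2])
  refine ⟨Submodule.span 𝕜 (Set.range v), FiniteDimensional.span_of_finite 𝕜 (Set.finite_range v),
    fun f hf => norm_apply_le_of_forall_norm_eq_one (V := (Submodule.span 𝕜 (Set.range v))ᗮ)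
      (fun g hg hg1 => ?_) hf⟩
  have hcons := orthonormal_finCons hv hg1 fun i => hg _ (Submodule.subset_span ⟨i, rfl⟩)
  have hsum := le_csSup hbdd ⟨n + 1, _, hcons, rfl⟩
  rw [Fin.sum_univ_succ] at hsum
  simp only [Fin.cons_zero, Fin.cons_succ] at hsum
  exact le_of_sq_le_sq (by linarith) hε.le

theorem HilbertSchmidtBound.isCompactOperator [CompleteSpace H'] {A : H →L[𝕜] H'} {C : ℝ}
    (hA : HilbertSchmidtBound A C) : IsCompactOperator A := by
  refine isCompactOperator_of_form_le fun ε hε => ?_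
  obtain ⟨V, hV, hle⟩ := hA.exists_norm_apply_le hε
  refine ⟨V, ⊥, hV, inferInstance, fun u _ f hf => ?_⟩
  calc ‖⟪u, A f⟫_𝕜‖ ≤ ‖u‖ * ‖A f‖ := norm_inner_le_norm _ _
    _ ≤ ‖u‖ * (ε * ‖f‖) := by gcongr; exact hle f hf
    _ = ε * (‖u‖ * ‖f‖) := by ring

theorem HilbertSchmidtBound.card_mul_sq_le {A : H →L[𝕜] H'} {C θ : ℝ} (hA : HilbertSchmidtBound A C)
    (hθ : 0 ≤ θ) {V : Submodule 𝕜 H} (hV : ∀ f ∈ V, θ * ‖f‖ ≤ ‖A f‖) {n : ℕ} {v : Fin n → V}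
    (hv : Orthonormal 𝕜 v) : n * θ ^ 2 ≤ C := by
  have hvH : Orthonormal 𝕜 fun i => (v i : H) := hv.comp_linearIsometry V.subtypeₗᵢ
  calc n * θ ^ 2 = ∑ _i : Fin n, θ ^ 2 := by simp
    _ ≤ ∑ i, ‖A (v i)‖ ^ 2 := by
        gcongr with i
        simpa [hvH.1 i] using hV (v i) (v i).2
    _ ≤ C := hA n _ hvH

theorem HilbertSchmidtBound.finiteDimensional {A : H →L[𝕜] H'} {C θ : ℝ}
    (hA : HilbertSchmidtBound A C) (hθ : 0 < θ) {V : Submodule 𝕜 H}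
    (hV : ∀ f ∈ V, θ * ‖f‖ ≤ ‖A f‖) : FiniteDimensional 𝕜 V := by
  by_contra hinf
  obtain ⟨n, hn⟩ := exists_nat_gt (C / θ ^ 2)
  have hrank : (n : Cardinal) ≤ Module.rank 𝕜 V :=
    Cardinal.natCast_le_aleph0.trans (not_lt.1 (Module.rank_lt_aleph0_iff.not.2 hinf))
  obtain ⟨v, hv⟩ := exists_linearIndependent_of_le_rank hrank
  have hcard := hA.card_mul_sq_le hθ.le hV (InnerProductSpace.gramSchmidtNormed_orthonormal hv)
  rw [← le_div_iff₀ (by positivity)] at hcard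
  linarith

theorem HilbertSchmidtBound.finrank_mul_sq_le {A : H →L[𝕜] H'} {C θ : ℝ}
    (hA : HilbertSchmidtBound A C) (hθ : 0 < θ) {V : Submodule 𝕜 H}
    (hV : ∀ f ∈ V, θ * ‖f‖ ≤ ‖A f‖) : Module.finrank 𝕜 V * θ ^ 2 ≤ C :=
  have := hA.finiteDimensional hθ hV
  hA.card_mul_sq_le hθ.le hV (stdOrthonormalBasis 𝕜 V).orthonormal

end HilbertSchmidt

section SingularValues

variable {H H' : Type*} [NormedAddCommGroup H] [InnerProductSpace ℂ H] [CompleteSpace H]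
  [NormedAddCommGroup H'] [InnerProductSpace ℂ H'] [CompleteSpace H']

/-- The span of the eigenspaces of `T* T` for the eigenvalues `t²` with `t > ε`. Its dimension is
the number of singular values of `T` above `ε`. -/
def upperSingularSpace (T : H →L[ℂ] H') (ε : ℝ) : Submodule ℂ H :=
  ⨆ t : Set.Ioi ε, singularSpace T t

theorem mem_singularSpace_iff {T : H →L[ℂ] H'} {t : ℝ} {f : H} :
    f ∈ singularSpace T t ↔ T.adjoint (T f) = (t : ℂ) ^ 2 • f :=
  Module.End.mem_eigenspace_iff

theorem orthogonalFamily_singularSpace (T : H →L[ℂ] H') {ε : ℝ} (hε : 0 ≤ ε) :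
    OrthogonalFamily ℂ (fun t : Set.Ioi ε => singularSpace T t)
      fun t => (singularSpace T t).subtypeₗᵢ := by
  refine T.isPositive_adjoint_comp_self.isSymmetric.orthogonalFamily_eigenspaces.comp
    (f := fun t : Set.Ioi ε => ((t : ℝ) : ℂ) ^ 2) fun s t hst => ?_
  have hsq : (s : ℝ) ^ 2 = (t : ℝ) ^ 2 := Complex.ofReal_injective (by push_cast; exact hst)
  exact Subtype.ext ((sq_eq_sq₀ (hε.trans s.2.le) (hε.trans t.2.le)).1 hsq)

theorem norm_sq_apply_sum_singularSpace (T : H →L[ℂ] H') {ε : ℝ} (hε : 0 ≤ ε)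
    (w : ∀ t : Set.Ioi ε, singularSpace T t) (s : Finset (Set.Ioi ε)) :
    ‖T (∑ t ∈ s, (w t : H))‖ ^ 2 = ∑ t ∈ s, (t : ℝ) ^ 2 * ‖w t‖ ^ 2 := by
  have hinner : ⟪∑ t ∈ s, (w t : H),
        ∑ t ∈ s, (((t : ℂ) ^ 2 • w t : singularSpace T t) : H)⟫_ℂ =
      ∑ t ∈ s, ⟪w t, (t : ℂ) ^ 2 • w t⟫_ℂ :=
    (orthogonalFamily_singularSpace T hε).inner_sum w (fun t => (t : ℂ) ^ 2 • w t) s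
  have happly : ∑ t ∈ s, (((t : ℂ) ^ 2 • w t : singularSpace T t) : H) =
      T.adjoint (T (∑ t ∈ s, (w t : H))) := by
    simp only [map_sum]
    exact Finset.sum_congr rfl fun t _ => (mem_singularSpace_iff.1 (w t).2).symm
  rw [happly, ContinuousLinearMap.adjoint_inner_right] at hinner
  simp only [inner_smul_right, inner_self_eq_norm_sq_to_K, Complex.coe_algebraMap] at hinner
  exact_mod_cast hinner

theorem mul_norm_lt_norm_apply_of_mem_upperSingularSpace {T : H →L[ℂ] H'} {ε : ℝ} (hε : 0 ≤ ε)
    {f : H} (hf : f ∈ upperSingularSpace T ε) (hf0 : f ≠ 0) : ε * ‖f‖ < ‖T f‖ := by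
  obtain ⟨g, hg, rfl⟩ := (Submodule.mem_iSup_iff_exists_finsupp _ _).1 hf
  set w : ∀ t : Set.Ioi ε, singularSpace T t := fun t => ⟨g t, hg t⟩
  have hnorm : ‖∑ t ∈ g.support, g t‖ ^ 2 = ∑ t ∈ g.support, ‖g t‖ ^ 2 :=
    (orthogonalFamily_singularSpace T hε).norm_sum w g.support
  have hTnorm : ‖T (∑ t ∈ g.support, g t)‖ ^ 2 = ∑ t ∈ g.support, (t : ℝ) ^ 2 * ‖g t‖ ^ 2 :=
    norm_sq_apply_sum_singularSpace T hε w g.support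
  refine lt_of_pow_lt_pow_left₀ 2 (norm_nonneg _) ?_
  rw [Finsupp.sum, mul_pow, hnorm, hTnorm, Finset.mul_sum]
  refine Finset.sum_lt_sum_of_nonempty (Finset.nonempty_of_sum_ne_zero hf0) fun t ht => ?_
  have hgt : 0 < ‖g t‖ := norm_pos_iff.2 (Finsupp.mem_support_iff.1 ht)
  have hεt : ε < t := t.2
  gcongr

theorem norm_le_of_hasEigenvalue_norm_le {B : H →L[ℂ] H} (hcomp : IsCompactOperator B)
    (hself : IsSelfAdjoint B) {c : ℝ} (hc : 0 ≤ c)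
    (h : ∀ μ, Module.End.HasEigenvalue (B : H →ₗ[ℂ] H) μ → ‖μ‖ ≤ c) : ‖B‖ ≤ c := by
  have hradius : spectralRadius ℂ B ≤ ENNReal.ofReal c := by
    refine iSup₂_le fun μ hμ => ?_
    rcases eq_or_ne μ 0 with rfl | hμ0
    · simp
    rw [← enorm_eq_nnnorm, ← ofReal_norm]
    exact ENNReal.ofReal_le_ofReal (h μ ((hcomp.hasEigenvalue_iff_mem_spectrum hμ0).2 hμ))
  rw [B.spectralRadius_eq_nnnorm hself, ← enorm_eq_nnnorm, ← ofReal_norm] at hradius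
  exact (ENNReal.ofReal_le_ofReal_iff hc).1 hradius

theorem upperSingularSpace_mem_invtSubmodule {T : H →L[ℂ] H'} {B : H →L[ℂ] H}
    (hB : Commute (T.adjoint ∘L T) B) (ε : ℝ) :
    upperSingularSpace T ε ∈ Module.End.invtSubmodule (B : H →ₗ[ℂ] H) := by
  have hcomm : Commute ((T.adjoint ∘L T : H →L[ℂ] H) : H →ₗ[ℂ] H) (B : H →ₗ[ℂ] H) :=
    congrArg ContinuousLinearMap.toLinearMap hB
  refine (iSup_le fun t f hf => ?_ : ⨆ t : Set.Ioi ε, singularSpace T t ≤ _)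
  exact Submodule.mem_iSup_of_mem t (Module.End.mapsTo_genEigenspace_of_comm hcomm _ 1 hf)

theorem orthogonal_upperSingularSpace_mem_invtSubmodule {T : H →L[ℂ] H'} {B : H →L[ℂ] H}
    (hself : IsSelfAdjoint B) (hB : Commute (T.adjoint ∘L T) B) (ε : ℝ) :
    (upperSingularSpace T ε)ᗮ ∈ Module.End.invtSubmodule (B : H →ₗ[ℂ] H) :=
  hself.isSymmetric.orthogonalComplement_mem_invtSubmodule
    (upperSingularSpace_mem_invtSubmodule hB ε)

/- The vector `x` lies in the singular space for `t = ‖T x‖ / ‖x‖`, so `t` cannot exceed `θ`. -/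
theorem norm_le_sq_of_mem_orthogonal_upperSingularSpace {T : H →L[ℂ] H'} {θ : ℝ} {μ : ℂ} {x : H}
    (hx : x ∈ (upperSingularSpace T θ)ᗮ) (hx0 : x ≠ 0) (hμ : T.adjoint (T x) = μ • x) :
    ‖μ‖ ≤ θ ^ 2 := by
  set t := ‖T x‖ / ‖x‖
  have ht0 : 0 ≤ t := by positivity
  have hμt : μ = (t : ℂ) ^ 2 := by
    have hxx : (‖x‖ : ℂ) ≠ 0 := by simpa using hx0
    have hinner : ⟪x, T.adjoint (T x)⟫_ℂ = μ * ‖x‖ ^ 2 := by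
      rw [hμ, inner_smul_right, inner_self_eq_norm_sq_to_K]; rfl
    rw [ContinuousLinearMap.adjoint_inner_right, inner_self_eq_norm_sq_to_K] at hinner
    rw [Complex.ofReal_div, div_pow, eq_div_iff (pow_ne_zero 2 hxx)]
    exact hinner.symm
  have htθ : t ≤ θ := by
    by_contra hlt
    have hmem : x ∈ upperSingularSpace T θ :=
      Submodule.mem_iSup_of_mem (⟨t, not_le.1 hlt⟩ : Set.Ioi θ)
        (mem_singularSpace_iff.2 (hμ.trans (by rw [hμt])))
    exact hx0 (inner_self_eq_zero.1 (hx x hmem))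
  rw [hμt, norm_pow, Complex.norm_real, Real.norm_of_nonneg ht0]
  gcongr

theorem norm_apply_le_of_mem_orthogonal_upperSingularSpace {T : H →L[ℂ] H'}
    (hT : IsCompactOperator T) {θ : ℝ} (hθ : 0 ≤ θ) {f : H}
    (hf : f ∈ (upperSingularSpace T θ)ᗮ) : ‖T f‖ ≤ θ * ‖f‖ := by
  set A : H →L[ℂ] H := T.adjoint ∘L T
  have hself : IsSelfAdjoint A := T.isPositive_adjoint_comp_self.isSelfAdjoint
  have hinv := orthogonal_upperSingularSpace_mem_invtSubmodule hself (Commute.refl A) θ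
  set B : (upperSingularSpace T θ)ᗮ →L[ℂ] (upperSingularSpace T θ)ᗮ := A.restrict hinv
  have hBcomp : IsCompactOperator B := (hT.clm_comp T.adjoint).restrict' hinv
  have hBself : IsSelfAdjoint B :=
    (show B.IsSymmetric from hself.isSymmetric.restrict_invariant hinv).isSelfAdjoint
  have hBnorm : ‖B‖ ≤ θ ^ 2 := norm_le_of_hasEigenvalue_norm_le hBcomp hBself (sq_nonneg θ)
    fun μ hμ => by
      obtain ⟨x, hx⟩ := hμ.exists_hasEigenvector
      exact norm_le_sq_of_mem_orthogonal_upperSingularSpace x.2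
        (fun h0 => hx.2 (Subtype.ext h0)) (congrArg Subtype.val hx.apply_eq_smul)
  have hAf : ‖A f‖ ≤ θ ^ 2 * ‖f‖ := B.le_of_opNorm_le hBnorm ⟨f, hf⟩
  refine le_of_sq_le_sq ?_ (by positivity)
  calc ‖T f‖ ^ 2 = RCLike.re ⟪A f, f⟫_ℂ := T.apply_norm_sq_eq_inner_adjoint_left f
    _ ≤ ‖A f‖ * ‖f‖ := re_inner_le_norm _ _
    _ ≤ θ ^ 2 * ‖f‖ * ‖f‖ := by gcongr
    _ = (θ * ‖f‖) ^ 2 := by ring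

/- On the complement of the upper singular space of `A`, which it leaves invariant, `A` has norm at
most `θ`; hence so have its powers, relative to `θ ^ j`. -/
theorem norm_pow_apply_le_of_mem_orthogonal_upperSingularSpace {A : H →L[ℂ] H}
    (hself : IsSelfAdjoint A) (hcomp : IsCompactOperator A) {θ : ℝ} (hθ : 0 ≤ θ) (j : ℕ) {f : H}
    (hf : f ∈ (upperSingularSpace A θ)ᗮ) : ‖(A ^ j) f‖ ≤ θ ^ j * ‖f‖ := by
  have hcomm : Commute (A.adjoint ∘L A) A := by
    rw [hself.adjoint_eq]
    exact (Commute.refl A).mul_left (Commute.refl A)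
  have hinv := orthogonal_upperSingularSpace_mem_invtSubmodule hself hcomm θ
  induction j generalizing f with
  | zero => simp
  | succ j ih =>
    calc ‖(A ^ (j + 1)) f‖ = ‖(A ^ j) (A f)‖ := by rw [pow_succ]; rfl
      _ ≤ θ ^ j * ‖A f‖ := ih (hinv hf)
      _ ≤ θ ^ j * (θ * ‖f‖) := by
        gcongr; exact norm_apply_le_of_mem_orthogonal_upperSingularSpace hcomp hθ hf
      _ = θ ^ (j + 1) * ‖f‖ := by ring

theorem HilbertSchmidtBound.exists_norm_pow_apply_le {A : H →L[ℂ] H} {C θ : ℝ}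
    (hA : HilbertSchmidtBound A C) (hself : IsSelfAdjoint A) (hθ : 0 < θ) :
    ∃ V : Submodule ℂ H, FiniteDimensional ℂ V ∧ Module.finrank ℂ V * θ ^ 2 ≤ C ∧
      ∀ j : ℕ, ∀ f ∈ Vᗮ, ‖(A ^ j) f‖ ≤ θ ^ j * ‖f‖ := by
  have hV : ∀ f ∈ upperSingularSpace A θ, θ * ‖f‖ ≤ ‖A f‖ := fun f hf => by
    rcases eq_or_ne f 0 with rfl | hf0
    · simp
    · exact (mul_norm_lt_norm_apply_of_mem_upperSingularSpace hθ.le hf hf0).le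
  exact ⟨upperSingularSpace A θ, hA.finiteDimensional hθ hV, hA.finrank_mul_sq_le hθ hV,
    fun j f hf => norm_pow_apply_le_of_mem_orthogonal_upperSingularSpace hself
      hA.isCompactOperator hθ.le j hf⟩

theorem singularValue_nonneg (T : H →L[ℂ] H') (n : ℕ) : 0 ≤ singularValue T n :=
  Real.sInf_nonneg fun _ hs => hs.1

theorem singularValue_le_of_rank_le {T : H →L[ℂ] H'} {ε : ℝ} (hε : 0 ≤ ε) {n : ℕ}
    (h : Module.rank ℂ (upperSingularSpace T ε) ≤ n) : singularValue T n ≤ ε :=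
  csInf_le ⟨0, fun _ hs => hs.1⟩ ⟨hε, h⟩

/- A vector `f` of the upper singular space is determined by the projections of `f` to `V` and of
`T f` to `V'`: where both vanish, the bound on the form with `u = T f` forces `‖T f‖ ≤ ε ‖f‖`. -/
theorem singularValue_le_of_form_le {T : H →L[ℂ] H'} {V : Submodule ℂ H} {V' : Submodule ℂ H'}
    [FiniteDimensional ℂ V] [FiniteDimensional ℂ V'] {ε : ℝ} (hε : 0 ≤ ε)
    (h : ∀ u ∈ V'ᗮ, ∀ f ∈ Vᗮ, ‖⟪u, T f⟫_ℂ‖ ≤ ε * (‖u‖ * ‖f‖)) {n : ℕ}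
    (hn : Module.finrank ℂ V + Module.finrank ℂ V' ≤ n) : singularValue T n ≤ ε := by
  let L : upperSingularSpace T ε →ₗ[ℂ] V × V' :=
    ((V.orthogonalProjectionOnto : H →ₗ[ℂ] V).prod
      ((V'.orthogonalProjectionOnto : H' →ₗ[ℂ] V') ∘ₗ (T : H →ₗ[ℂ] H'))) ∘ₗ
        (upperSingularSpace T ε).subtype
  have hL : Function.Injective L := by
    refine (injective_iff_map_eq_zero L).2 fun ⟨f, hf⟩ hLf => ?_
    have hVf : f ∈ Vᗮ := V.orthogonalProjectionOnto_eq_zero_iff.1 (congrArg Prod.fst hLf)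
    have hVTf : T f ∈ V'ᗮ := V'.orthogonalProjectionOnto_eq_zero_iff.1 (congrArg Prod.snd hLf)
    have hTf : ‖T f‖ ≤ ε * ‖f‖ := by
      have := norm_sub_starProjection_comp_le_of_form_le hε h hVf
      rwa [(V'.starProjection_apply_eq_zero_iff).2 hVTf, sub_zero] at this
    by_contra hf0
    exact hTf.not_gt (mul_norm_lt_norm_apply_of_mem_upperSingularSpace hε hf
      fun h0 => hf0 (Subtype.ext h0))
  have : FiniteDimensional ℂ (upperSingularSpace T ε) := FiniteDimensional.of_injective L hL
  have hdim := LinearMap.finrank_le_finrank_of_injective hL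
  rw [Module.finrank_prod] at hdim
  refine singularValue_le_of_rank_le hε ?_
  rw [← Module.finrank_eq_rank]
  exact_mod_cast hdim.trans hn

theorem isSchatten_of_singularValue_le_rpow {T : H →L[ℂ] H'} (hT : IsCompactOperator T)
    {p α C : ℝ} (hp : 0 < p) (hα : 1 < α * p)
    (h : ∀ᶠ n : ℕ in Filter.atTop, singularValue T n ≤ C * (n : ℝ) ^ (-α)) : IsSchatten p T := by
  refine ⟨hT, ?_⟩
  have hmajorant : Summable fun n : ℕ => |C| ^ p * (n : ℝ) ^ (-α * p) :=
    (Real.summable_nat_rpow.2 (by linarith)).mul_left _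
  refine Summable.of_norm_bounded_eventually_nat hmajorant ?_
  filter_upwards [h] with n hn
  rw [Real.norm_of_nonneg (Real.rpow_nonneg (singularValue_nonneg T n) p),
    Real.rpow_mul n.cast_nonneg, ← Real.mul_rpow (abs_nonneg C) (by positivity)]
  refine Real.rpow_le_rpow (singularValue_nonneg T n) (hn.trans ?_) hp.le
  gcongr
  exact le_abs_self C

theorem isSchatten_of_form_decay {T : H →L[ℂ] H'} {d γ C D : ℝ} (hd : 0 < d) (hγ : 0 < γ)
    (hC : 0 ≤ C) (hD : 0 < D)
    (h : ∀ r : ℝ, 1 ≤ r → ∃ (V : Submodule ℂ H) (V' : Submodule ℂ H'),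
      FiniteDimensional ℂ V ∧ FiniteDimensional ℂ V' ∧
      (Module.finrank ℂ V + Module.finrank ℂ V' : ℝ) ≤ D * r ^ d ∧
      ∀ u ∈ V'ᗮ, ∀ f ∈ Vᗮ, ‖⟪u, T f⟫_ℂ‖ ≤ C * r ^ (-γ) * (‖u‖ * ‖f‖))
    {p : ℝ} (hp : d / γ < p) : IsSchatten p T := by
  have hcomp : IsCompactOperator T := isCompactOperator_of_form_le fun ε hε => by
    have hlim : Filter.Tendsto (fun r : ℝ => C * r ^ (-γ)) Filter.atTop (nhds 0) := by
      simpa using (tendsto_rpow_neg_atTop hγ).const_mul C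
    obtain ⟨r, hr, hr1⟩ := ((hlim.eventually_lt_const hε).and (Filter.eventually_ge_atTop 1)).exists
    obtain ⟨V, V', hV, hV', -, hform⟩ := h r hr1
    exact ⟨V, V', hV, hV', fun u hu f hf => (hform u hu f hf).trans (by gcongr)⟩
  refine isSchatten_of_singularValue_le_rpow (α := γ / d) (C := C * D ^ (γ / d)) hcomp
    ((div_pos hd hγ).trans hp) (by rwa [div_mul_eq_mul_div, one_lt_div hd, mul_comm,
      ← div_lt_iff₀ hγ]) ?_
  filter_upwards [Filter.eventually_ge_atTop ⌈D⌉₊] with n hn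
  have hDn : 1 ≤ n / D := (one_le_div hD).2 (Nat.ceil_le.1 hn)
  obtain ⟨V, V', _, _, hdim, hform⟩ := h ((n / D) ^ d⁻¹) (Real.one_le_rpow hDn (by positivity))
  rw [Real.rpow_inv_rpow (by positivity) hd.ne', mul_div_cancel₀ _ hD.ne'] at hdim
  refine (singularValue_le_of_form_le (by positivity) hform (by exact_mod_cast hdim)).trans_eq ?_
  rw [← Real.rpow_mul (by positivity), Real.div_rpow n.cast_nonneg hD.le,
    show d⁻¹ * -γ = -(γ / d) by ring, Real.rpow_neg hD.le (γ / d), div_inv_eq_mul]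
  ring

end SingularValues

section ExponentialIntegrals

theorem integrableOn_exp_neg_mul {a : ℝ} (ha : 0 < a) :
    IntegrableOn (fun t : ℝ => Real.exp (-a * t)) (Set.Ioi 0) :=
  integrableOn_exp_mul_Ioi (neg_neg_of_pos ha) 0

theorem integral_exp_neg_mul {a : ℝ} (ha : 0 < a) :
    ∫ t in Set.Ioi (0 : ℝ), Real.exp (-a * t) = 1 / a := by
  rw [integral_exp_mul_Ioi (neg_neg_of_pos ha)]
  simp [neg_div_neg_eq]

theorem integrableOn_rpow_neg_mul_exp_neg_mul {a β : ℝ} (hβ : β < 1) (ha : 0 < a) :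
    IntegrableOn (fun t : ℝ => t ^ (-β) * Real.exp (-a * t)) (Set.Ioi 0) := by
  simpa using integrableOn_rpow_mul_exp_neg_mul_rpow (p := 1) (s := -β) (b := a)
    (by linarith) one_pos ha

theorem integral_rpow_neg_mul_exp_neg_mul {a β : ℝ} (hβ : β < 1) (ha : 0 < a) :
    ∫ t in Set.Ioi (0 : ℝ), t ^ (-β) * Real.exp (-a * t) =
      Real.Gamma (1 - β) * a ^ (-(1 - β)) := by
  have h := Real.integral_rpow_mul_exp_neg_mul_Ioi (a := 1 - β) (sub_pos.2 hβ) ha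
  rw [one_div, Real.inv_rpow ha.le, ← Real.rpow_neg ha.le, sub_right_comm, sub_self, zero_sub] at h
  rw [mul_comm (Real.Gamma _)]
  simpa only [neg_mul] using h

theorem exists_exp_neg_mul_le_rpow_neg {c : ℝ} (hc : 0 < c) (s : ℝ) :
    ∃ D : ℝ, 0 ≤ D ∧ ∀ r : ℝ, 1 ≤ r → Real.exp (-(c * r)) ≤ D * r ^ (-s) := by
  set m := ⌈s⌉₊
  refine ⟨m.factorial / c ^ m, by positivity, fun r hr => ?_⟩
  have hr0 : 0 < r := one_pos.trans_le hr
  calc Real.exp (-(c * r)) = (Real.exp (c * r))⁻¹ := Real.exp_neg _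
    _ ≤ ((c * r) ^ m / m.factorial)⁻¹ :=
        inv_anti₀ (by positivity) (Real.pow_div_factorial_le_exp _ (by positivity) m)
    _ = m.factorial / c ^ m * r ^ (-(m : ℝ)) := by
        rw [Real.rpow_neg hr0.le, Real.rpow_natCast, mul_pow]
        field_simp
    _ ≤ m.factorial / c ^ m * r ^ (-s) := by
        gcongr
        exact Nat.le_ceil s

end ExponentialIntegrals

section LaplaceTransforms

variable {H K L : Type*} [NormedAddCommGroup H] [InnerProductSpace ℂ H]
  [NormedAddCommGroup K] [InnerProductSpace ℂ K] [NormedAddCommGroup L] [InnerProductSpace ℂ L]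

/-- `G` is the Laplace transform `∫₀^∞ exp (-lam t) S t dt` of the family `S` at the point `lam`, in
the weak sense, which needs no measurability of `S` in the operator norm. -/
def IsWeakLaplaceTransform (lam : ℝ) (S : ℝ → H →L[ℂ] K) (G : H →L[ℂ] K) : Prop :=
  ∀ (u : K) (f : H), ⟪u, G f⟫_ℂ =
    ∫ t in Set.Ioi (0 : ℝ), (Real.exp (-lam * t) : ℂ) * ⟪u, S t f⟫_ℂ

variable {lam : ℝ}

theorem IsWeakLaplaceTransform.clm_comp [CompleteSpace K] [CompleteSpace L] {S : ℝ → H →L[ℂ] K}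
    {G : H →L[ℂ] K} (hG : IsWeakLaplaceTransform lam S G) (A : K →L[ℂ] L) :
    IsWeakLaplaceTransform lam (fun t => A ∘L S t) (A ∘L G) := fun u f => by
  simp only [ContinuousLinearMap.comp_apply, ← ContinuousLinearMap.adjoint_inner_left]
  exact hG _ f

theorem IsWeakLaplaceTransform.norm_apply_le {S : ℝ → H →L[ℂ] K} {G : H →L[ℂ] K}
    (hG : IsWeakLaplaceTransform lam S G) (hlam : 0 < lam) {f : H} {g : ℝ → ℝ} {B : ℝ}
    (hg : IntegrableOn g (Set.Ioi 0)) (hg0 : ∀ t, 0 < t → 0 ≤ g t) (hB : 0 ≤ B)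
    (h : ∀ t, 0 < t → ‖S t f‖ ≤ g t + B) : ‖G f‖ ≤ (∫ t in Set.Ioi (0 : ℝ), g t) + B / lam := by
  have hint : 0 ≤ ∫ t in Set.Ioi (0 : ℝ), g t := setIntegral_nonneg measurableSet_Ioi hg0
  have hexp := integrableOn_exp_neg_mul hlam
  refine norm_le_of_forall_norm_inner_le (𝕜 := ℂ) (by positivity) fun u => ?_
  calc ‖⟪u, G f⟫_ℂ‖ ≤ ∫ t in Set.Ioi (0 : ℝ), (g t + B * Real.exp (-lam * t)) * ‖u‖ := by
        rw [hG u f]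
        refine norm_integral_le_of_norm_le ((hg.add (hexp.const_mul B)).mul_const ‖u‖)
          ((ae_restrict_mem measurableSet_Ioi).mono fun t (ht : 0 < t) => ?_)
        have hexp1 : Real.exp (-lam * t) ≤ 1 := Real.exp_le_one_iff.2 (by nlinarith)
        rw [norm_mul, Complex.norm_real, Real.norm_of_nonneg (Real.exp_pos _).le]
        calc Real.exp (-lam * t) * ‖⟪u, S t f⟫_ℂ‖ ≤ Real.exp (-lam * t) * (‖u‖ * (g t + B)) := by
              gcongr
              exact (norm_inner_le_norm _ _).trans (by gcongr; exact h t ht)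
          _ = (Real.exp (-lam * t) * g t + B * Real.exp (-lam * t)) * ‖u‖ := by ring
          _ ≤ (g t + B * Real.exp (-lam * t)) * ‖u‖ := by
              gcongr
              exact mul_le_of_le_one_left (hg0 t ht) hexp1
    _ = ((∫ t in Set.Ioi (0 : ℝ), g t) + B / lam) * ‖u‖ := by
        rw [integral_mul_const, integral_add hg (hexp.const_mul B), integral_const_mul,
          integral_exp_neg_mul hlam, mul_one_div]

variable {G : K →L[ℂ] K} {P : H →L[ℂ] K} {S : ℝ → K →L[ℂ] K} {E : ℝ → H →L[ℂ] K} {a A B β : ℝ}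

theorem IsWeakLaplaceTransform.norm_pow_apply_le [CompleteSpace K] (hlam : 0 < lam)
    (hG : IsWeakLaplaceTransform lam S G)
    (hSE : ∀ s t, 0 < s → 0 < t → ∀ f, S s (E t f) = E (s + t) f)
    (hβ : 0 ≤ β) (ha : 0 < a) (hA : 0 ≤ A) (hB : 0 ≤ B) {f : H}
    (hf : ∀ t, 0 < t → ‖E t f‖ ≤ A * (t ^ (-β) * Real.exp (-a * t)) + B) (m : ℕ)
    {t : ℝ} (ht : 0 < t) :
    ‖(G ^ m) (E t f)‖ ≤ A / a ^ m * (t ^ (-β) * Real.exp (-a * t)) + B / lam ^ m := by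
  induction m generalizing t with
  | zero => simpa using hf t ht
  | succ m ih =>
    set M := A / a ^ m * (t ^ (-β) * Real.exp (-a * t))
    have hdecay : ∀ s, 0 < s → ‖(G ^ m) (S s (E t f))‖ ≤ M * Real.exp (-a * s) + B / lam ^ m := by
      intro s hs
      have hrpow : (s + t) ^ (-β) ≤ t ^ (-β) :=
        Real.rpow_le_rpow_of_nonpos ht (by linarith) (neg_nonpos.2 hβ)
      have hexp : Real.exp (-a * (s + t)) = Real.exp (-a * t) * Real.exp (-a * s) := by
        rw [← Real.exp_add]; ring_nf
      rw [hSE s t hs ht]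
      calc ‖(G ^ m) (E (s + t) f)‖
          ≤ A / a ^ m * ((s + t) ^ (-β) * Real.exp (-a * (s + t))) + B / lam ^ m :=
            ih (by positivity)
        _ ≤ A / a ^ m * (t ^ (-β) * (Real.exp (-a * t) * Real.exp (-a * s))) + B / lam ^ m := by
            rw [hexp]; gcongr
        _ = M * Real.exp (-a * s) + B / lam ^ m := by ring
    calc ‖(G ^ (m + 1)) (E t f)‖ = ‖(G ^ m) (G (E t f))‖ := by
          rw [pow_succ, mul_apply_eq_comp]
      _ ≤ (∫ s in Set.Ioi (0 : ℝ), M * Real.exp (-a * s)) + B / lam ^ m / lam :=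
          (hG.clm_comp (G ^ m)).norm_apply_le hlam ((integrableOn_exp_neg_mul ha).const_mul M)
            (fun s _ => by positivity) (by positivity) hdecay
      _ = A / a ^ (m + 1) * (t ^ (-β) * Real.exp (-a * t)) + B / lam ^ (m + 1) := by
          rw [integral_const_mul, integral_exp_neg_mul ha, pow_succ, pow_succ]
          simp only [M]
          field_simp

theorem IsWeakLaplaceTransform.norm_pow_comp_apply_le [CompleteSpace K] (hlam : 0 < lam)
    (hG : IsWeakLaplaceTransform lam S G) (hP : IsWeakLaplaceTransform lam E P)
    (hSE : ∀ s t, 0 < s → 0 < t → ∀ f, S s (E t f) = E (s + t) f)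
    (hβ : 0 ≤ β) (hβ1 : β < 1) (ha : 0 < a) (hA : 0 ≤ A) (hB : 0 ≤ B) {f : H}
    (hf : ∀ t, 0 < t → ‖E t f‖ ≤ A * (t ^ (-β) * Real.exp (-a * t)) + B) (m : ℕ) :
    ‖(G ^ m) (P f)‖ ≤ A * Real.Gamma (1 - β) * a ^ (-(m + (1 - β))) + B / lam ^ (m + 1) := by
  calc ‖((G ^ m) ∘L P) f‖
      ≤ (∫ t in Set.Ioi (0 : ℝ), A / a ^ m * (t ^ (-β) * Real.exp (-a * t))) + B / lam ^ m / lam :=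
        (hP.clm_comp (G ^ m)).norm_apply_le hlam
          ((integrableOn_rpow_neg_mul_exp_neg_mul hβ1 ha).const_mul _)
          (fun t _ => by positivity) (by positivity)
          (fun t ht => hG.norm_pow_apply_le hlam hSE hβ ha hA hB hf m ht)
    _ = A * Real.Gamma (1 - β) * a ^ (-(m + (1 - β))) + B / lam ^ (m + 1) := by
        rw [integral_const_mul, integral_rpow_neg_mul_exp_neg_mul hβ1 ha, neg_add,
          Real.rpow_add ha, Real.rpow_neg ha.le (m : ℝ), Real.rpow_natCast, pow_succ]
        field_simp

theorem IsWeakLaplaceTransform.exists_norm_pow_comp_apply_le [CompleteSpace K] (hlam : 0 < lam)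
    (hG : IsWeakLaplaceTransform lam S G) (hP : IsWeakLaplaceTransform lam E P)
    (hSE : ∀ s t, 0 < s → 0 < t → ∀ f, S s (E t f) = E (s + t) f)
    (hβ : 0 ≤ β) (hβ1 : β < 1) {c C : ℝ} (hc : 0 < c) (hC : 0 ≤ C) (m : ℕ) :
    ∃ D : ℝ, 0 ≤ D ∧ ∀ (r : ℝ) (f : H), 1 ≤ r →
      (∀ t, 0 < t →
        ‖E t f‖ ≤ C * (t ^ (-β) * Real.exp (-(c * r) * t) + Real.exp (-(c * r))) * ‖f‖) →
      ‖(G ^ m) (P f)‖ ≤ D * r ^ (-(m + (1 - β))) * ‖f‖ := by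
  obtain ⟨D, hD, hexp⟩ := exists_exp_neg_mul_le_rpow_neg hc (m + (1 - β))
  have : 0 < Real.Gamma (1 - β) := Real.Gamma_pos_of_pos (sub_pos.2 hβ1)
  refine ⟨C * Real.Gamma (1 - β) * c ^ (-(m + (1 - β))) + C * D / lam ^ (m + 1),
    by positivity, fun r f hr hf => ?_⟩
  have hr0 : 0 < r := one_pos.trans_le hr
  calc ‖(G ^ m) (P f)‖
      ≤ C * ‖f‖ * Real.Gamma (1 - β) * (c * r) ^ (-(m + (1 - β))) +
          C * Real.exp (-(c * r)) * ‖f‖ / lam ^ (m + 1) :=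
        hG.norm_pow_comp_apply_le hlam hP hSE hβ hβ1 (by positivity) (by positivity)
          (by positivity) (fun t ht => (hf t ht).trans_eq (by ring)) m
    _ ≤ C * ‖f‖ * Real.Gamma (1 - β) * (c ^ (-(m + (1 - β))) * r ^ (-(m + (1 - β)))) +
          C * (D * r ^ (-(m + (1 - β)))) * ‖f‖ / lam ^ (m + 1) := by
        rw [Real.mul_rpow hc.le hr0.le]
        gcongr
        exact hexp r hr
    _ = _ := by ring

theorem isSchatten_adjoint_comp_pow_comp [CompleteSpace H] [CompleteSpace K] (hlam : 0 < lam)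
    (hG : IsWeakLaplaceTransform lam S G) (hP : IsWeakLaplaceTransform lam E P)
    (hSE : ∀ s t, 0 < s → 0 < t → ∀ f, S s (E t f) = E (s + t) f)
    (hβ : 0 ≤ β) (hβ1 : β < 1) {c C D d : ℝ} (hc : 0 < c) (hC : 0 ≤ C) (hD : 0 < D) (hd : 0 < d)
    (hV : ∀ r : ℝ, 1 ≤ r → ∃ V : Submodule ℂ H, FiniteDimensional ℂ V ∧
      Module.finrank ℂ V ≤ D * r ^ d ∧ ∀ f ∈ Vᗮ, ∀ t, 0 < t →
        ‖E t f‖ ≤ C * (t ^ (-β) * Real.exp (-(c * r) * t) + Real.exp (-(c * r))) * ‖f‖)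
    (k : ℕ) {p : ℝ} (hp : d / (k + 2 * (1 - β)) < p) :
    IsSchatten p (P.adjoint ∘L (G ^ k) ∘L P) := by
  obtain ⟨D₀, hD₀, hbound₀⟩ := hG.exists_norm_pow_comp_apply_le hlam hP hSE hβ hβ1 hc hC 0
  obtain ⟨D₁, hD₁, hbound⟩ := hG.exists_norm_pow_comp_apply_le hlam hP hSE hβ hβ1 hc hC k
  have : 0 < 1 - β := sub_pos.2 hβ1
  refine isSchatten_of_form_decay (C := D₀ * D₁) (D := 2 * D) hd (by positivity) (by positivity)
    (by positivity) (fun r hr => ?_) hp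
  obtain ⟨V, hfin, hdim, hdecay⟩ := hV r hr
  refine ⟨V, V, hfin, hfin, by linarith, fun u hu f hf => ?_⟩
  have hr0 : 0 < r := one_pos.trans_le hr
  calc ‖⟪u, P.adjoint ((G ^ k) (P f))⟫_ℂ‖ ≤ ‖P u‖ * ‖(G ^ k) (P f)‖ := by
        rw [ContinuousLinearMap.adjoint_inner_right]
        exact norm_inner_le_norm _ _
    _ ≤ (D₀ * r ^ (-((0 : ℕ) + (1 - β))) * ‖u‖) * (D₁ * r ^ (-(k + (1 - β))) * ‖f‖) := by
        gcongr
        · exact hbound₀ r u hr (hdecay u hu)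
        · exact hbound r f hr (hdecay f hf)
    _ = D₀ * D₁ * (r ^ (-((0 : ℕ) + (1 - β))) * r ^ (-(k + (1 - β)))) * (‖u‖ * ‖f‖) := by ring
    _ = D₀ * D₁ * r ^ (-(k + 2 * (1 - β))) * (‖u‖ * ‖f‖) := by
        rw [← Real.rpow_add hr0, Nat.cast_zero]
        ring_nf

end LaplaceTransforms

section LintegralKernels

variable {X Y Z : Type*} [MeasurableSpace X] [MeasurableSpace Y] [MeasurableSpace Z]
  {μ : Measure X} {ν : Measure Y} {ρ : Measure Z}

theorem sq_lintegral_mul_le {f g : X → ℝ≥0∞} (hf : AEMeasurable f μ) (hg : AEMeasurable g μ) :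
    (∫⁻ x, f x * g x ∂μ) ^ 2 ≤ (∫⁻ x, f x ^ 2 ∂μ) * ∫⁻ x, g x ^ 2 ∂μ := by
  have hsq : ∀ a : ℝ≥0∞, (a ^ (1 / 2 : ℝ)) ^ 2 = a := fun a => by
    rw [← ENNReal.rpow_two, ← ENNReal.rpow_mul]; norm_num
  have h := ENNReal.lintegral_mul_le_Lp_mul_Lq μ Real.HolderConjugate.two_two hf hg
  simp only [Pi.mul_apply, ENNReal.rpow_two] at h
  simpa only [mul_pow, hsq] using pow_le_pow_left₀ zero_le h 2

theorem sq_lintegral_weight_mul_le {w f : X → ℝ≥0∞} (hw : Measurable w) (hf : Measurable f) :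
    (∫⁻ x, w x * f x ∂μ) ^ 2 ≤ (∫⁻ x, w x ∂μ) * ∫⁻ x, w x * f x ^ 2 ∂μ := by
  have h := sq_lintegral_mul_le (μ := μ.withDensity w) (aemeasurable_const (b := 1))
    hf.aemeasurable
  simpa only [one_mul, one_pow, lintegral_const, withDensity_apply _ MeasurableSet.univ,
    setLIntegral_univ, lintegral_withDensity_eq_lintegral_mul _ hw hf,
    lintegral_withDensity_eq_lintegral_mul _ hw (hf.pow_const 2), Pi.mul_apply] using h

theorem sq_lintegral_le_lintegral_mul_lintegral_inv_mul_sq {c f : X → ℝ≥0∞} (hc : Measurable c)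
    (hc0 : ∀ x, c x ≠ 0) (hctop : ∀ x, c x ≠ ∞) (hf : Measurable f) :
    (∫⁻ x, f x ∂μ) ^ 2 ≤ (∫⁻ x, c x ∂μ) * ∫⁻ x, (c x)⁻¹ * f x ^ 2 ∂μ := by
  have hcancel : ∀ x (a : ℝ≥0∞), c x * ((c x)⁻¹ * a) = a := fun x a => by
    rw [← mul_assoc, ENNReal.mul_inv_cancel (hc0 x) (hctop x), one_mul]
  have h := sq_lintegral_weight_mul_le (μ := μ) hc (hc.inv.mul hf)
  simpa only [Pi.mul_apply, Pi.inv_apply, mul_pow, sq (c _)⁻¹, mul_assoc, hcancel] using h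

variable {κ : Y → X → ℝ≥0∞} {C : ℝ≥0∞}

theorem measurable_lintegral_kernel_mul [SFinite μ] (hκ : Measurable fun z : Y × X => κ z.1 z.2)
    {f : X → ℝ≥0∞} (hf : Measurable f) : Measurable fun y => ∫⁻ x, κ y x * f x ∂μ :=
  Measurable.lintegral_prod_right' (f := fun z : Y × X => κ z.1 z.2 * f z.2)
    (hκ.mul (hf.comp measurable_snd))

theorem lintegral_mul_lintegral_kernel_mul [SFinite μ] [SFinite ν]
    (hκ : Measurable fun z : Y × X => κ z.1 z.2) {g : Y → ℝ≥0∞} (hg : Measurable g)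
    {f : X → ℝ≥0∞} (hf : Measurable f) :
    ∫⁻ y, g y * ∫⁻ x, κ y x * f x ∂μ ∂ν = ∫⁻ x, (∫⁻ y, g y * κ y x ∂ν) * f x ∂μ := by
  have hκy : ∀ y, Measurable fun x => κ y x * f x := fun y =>
    (hκ.comp measurable_prodMk_left).mul hf
  have hκx : ∀ x, Measurable fun y => g y * κ y x := fun x =>
    hg.mul (hκ.comp measurable_prodMk_right)
  simp only [← lintegral_const_mul _ (hκy _), ← lintegral_mul_const _ (hκx _), mul_assoc]
  exact lintegral_lintegral_swap
    ((hg.comp measurable_fst).mul (hκ.mul (hf.comp measurable_snd))).aemeasurable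

/-- The operator with the nonnegative kernel `κ` is bounded on `L²` with the constant `C`, expressed
through its action on nonnegative functions. -/
def KernelBound (μ : Measure X) (ν : Measure Y) (κ : Y → X → ℝ≥0∞) (C : ℝ≥0∞) : Prop :=
  ∀ f : X → ℝ≥0∞, Measurable f →
    ∫⁻ y, (∫⁻ x, κ y x * f x ∂μ) ^ 2 ∂ν ≤ C ^ 2 * ∫⁻ x, f x ^ 2 ∂μ

theorem KernelBound.mono {κ' : Y → X → ℝ≥0∞} (h : KernelBound μ ν κ C)
    (hle : ∀ y x, κ' y x ≤ κ y x) : KernelBound μ ν κ' C := fun f hf =>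
  (lintegral_mono fun y => by
    gcongr with x
    exact hle y x).trans (h f hf)

theorem KernelBound.mono_right {C' : ℝ≥0∞} (h : KernelBound μ ν κ C) (hle : C ≤ C') :
    KernelBound μ ν κ C' := fun f hf =>
  (h f hf).trans (by gcongr)

theorem KernelBound.const_mul (h : KernelBound μ ν κ C) {a : ℝ≥0∞} (ha : a ≠ ∞) :
    KernelBound μ ν (fun y x => a * κ y x) (a * C) := fun f hf => by
  simp only [mul_assoc, lintegral_const_mul' _ _ ha, mul_pow]
  rw [lintegral_const_mul' _ _ (by finiteness)]
  gcongr
  exact h f hf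

theorem kernelBound_of_schur [SFinite μ] [SFinite ν] (hκ : Measurable fun z : Y × X => κ z.1 z.2)
    (h₁ : ∀ y, ∫⁻ x, κ y x ∂μ ≤ C) (h₂ : ∀ x, ∫⁻ y, κ y x ∂ν ≤ C) : KernelBound μ ν κ C := by
  intro f hf
  have hκy : ∀ y, Measurable fun x => κ y x := fun y => hκ.comp measurable_prodMk_left
  have hf2 : Measurable fun x => f x ^ 2 := hf.pow_const 2
  calc ∫⁻ y, (∫⁻ x, κ y x * f x ∂μ) ^ 2 ∂ν
      ≤ ∫⁻ y, C * ∫⁻ x, κ y x * f x ^ 2 ∂μ ∂ν := by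
        refine lintegral_mono fun y => ?_
        refine (sq_lintegral_weight_mul_le (hκy y) hf).trans ?_
        gcongr
        exact h₁ y
    _ = C * ∫⁻ x, (∫⁻ y, κ y x ∂ν) * f x ^ 2 ∂μ := by
        rw [lintegral_const_mul _ (measurable_lintegral_kernel_mul hκ hf2)]
        simpa using congrArg (C * ·) (lintegral_mul_lintegral_kernel_mul hκ measurable_one hf2)
    _ ≤ C * ∫⁻ x, C * f x ^ 2 ∂μ := by
        gcongr with x
        exact h₂ x
    _ = C ^ 2 * ∫⁻ x, f x ^ 2 ∂μ := by
        rw [lintegral_const_mul _ hf2, sq, mul_assoc]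

theorem lintegral_sq_lintegral_kernel_mul [SFinite μ] [SFinite ν]
    (hκ : Measurable fun z : Y × X => κ z.1 z.2) {f : X → ℝ≥0∞} (hf : Measurable f) :
    ∫⁻ y, (∫⁻ x, κ y x * f x ∂μ) ^ 2 ∂ν =
      ∫⁻ x, f x * ∫⁻ x', (∫⁻ y, κ y x * κ y x' ∂ν) * f x' ∂μ ∂μ := by
  have hκf := measurable_lintegral_kernel_mul (μ := μ) hκ hf
  simp only [sq]
  rw [lintegral_mul_lintegral_kernel_mul hκ hκf hf]
  refine lintegral_congr fun x => ?_
  have hκx : Measurable fun y => κ y x := hκ.comp measurable_prodMk_right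
  rw [← lintegral_mul_lintegral_kernel_mul hκ hκx hf]
  simp only [mul_comm]

theorem kernelBound_of_schur_sq [SFinite μ] [SFinite ν]
    (hκ : Measurable fun z : Y × X => κ z.1 z.2)
    (h : ∀ x, ∫⁻ x', ∫⁻ y, κ y x * κ y x' ∂ν ∂μ ≤ C ^ 2) : KernelBound μ ν κ C := by
  intro f hf
  set L : X → X → ℝ≥0∞ := fun x x' => ∫⁻ y, κ y x * κ y x' ∂ν
  have hLsymm : ∀ x x', L x x' = L x' x := fun x x' => lintegral_congr fun y => mul_comm _ _
  have hL : Measurable fun z : X × X => L z.1 z.2 :=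
    Measurable.lintegral_prod_right' (f := fun z : (X × X) × Y => κ z.2 z.1.1 * κ z.2 z.1.2)
      ((hκ.comp (by fun_prop : Measurable fun z : (X × X) × Y => (z.2, z.1.1))).mul
        (hκ.comp (by fun_prop : Measurable fun z : (X × X) × Y => (z.2, z.1.2))))
  have hLbound : KernelBound μ μ L (C ^ 2) :=
    kernelBound_of_schur hL h fun x => by simpa only [hLsymm _ x] using h x
  rw [lintegral_sq_lintegral_kernel_mul hκ hf]
  refine (ENNReal.pow_le_pow_left_iff two_ne_zero).1 ?_
  calc (∫⁻ x, f x * ∫⁻ x', L x x' * f x' ∂μ ∂μ) ^ 2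
      ≤ (∫⁻ x, f x ^ 2 ∂μ) * ∫⁻ x, (∫⁻ x', L x x' * f x' ∂μ) ^ 2 ∂μ :=
        sq_lintegral_mul_le hf.aemeasurable (measurable_lintegral_kernel_mul hL hf).aemeasurable
    _ ≤ (∫⁻ x, f x ^ 2 ∂μ) * ((C ^ 2) ^ 2 * ∫⁻ x, f x ^ 2 ∂μ) := by
        gcongr
        exact hLbound f hf
    _ = (C ^ 2 * ∫⁻ x, f x ^ 2 ∂μ) ^ 2 := by ring

theorem kernelBound_lintegral [SFinite μ] [SFinite ν] [SFinite ρ] {k : Z → Y → X → ℝ≥0∞}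
    (hk : Measurable fun z : Z × Y × X => k z.1 z.2.1 z.2.2)
    {c : Z → ℝ≥0∞} (hc : Measurable c) (hc0 : ∀ t, c t ≠ 0) (hctop : ∀ t, c t ≠ ∞)
    (hb : ∀ᵐ t ∂ρ, KernelBound μ ν (k t) (c t)) :
    KernelBound μ ν (fun y x => ∫⁻ t, k t y x ∂ρ) (∫⁻ t, c t ∂ρ) := by
  intro f hf
  set φ : Z → Y → ℝ≥0∞ := fun t y => ∫⁻ x, k t y x * f x ∂μ
  have hφ : Measurable fun z : Z × Y => φ z.1 z.2 :=
    measurable_lintegral_kernel_mul (κ := fun z : Z × Y => k z.1 z.2)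
      (hk.comp MeasurableEquiv.prodAssoc.measurable) hf
  have hφsq : Measurable fun z : Z × Y => (c z.1)⁻¹ * φ z.1 z.2 ^ 2 :=
    (hc.inv.comp measurable_fst).mul (hφ.pow_const 2)
  have hφint : Measurable fun y => ∫⁻ t, (c t)⁻¹ * φ t y ^ 2 ∂ρ := hφsq.lintegral_prod_left'
  have hky : ∀ y, Measurable fun z : Z × X => k z.1 y z.2 := fun y =>
    hk.comp (by fun_prop : Measurable fun z : Z × X => (z.1, y, z.2))
  have hswap : ∀ y, ∫⁻ x, (∫⁻ t, k t y x ∂ρ) * f x ∂μ = ∫⁻ t, φ t y ∂ρ := fun y => by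
    simpa using (lintegral_mul_lintegral_kernel_mul (ν := ρ) (hky y) measurable_one hf).symm
  simp only [hswap]
  calc ∫⁻ y, (∫⁻ t, φ t y ∂ρ) ^ 2 ∂ν
      ≤ ∫⁻ y, (∫⁻ t, c t ∂ρ) * ∫⁻ t, (c t)⁻¹ * φ t y ^ 2 ∂ρ ∂ν :=
        lintegral_mono fun y => sq_lintegral_le_lintegral_mul_lintegral_inv_mul_sq hc hc0 hctop
          (hφ.comp measurable_prodMk_right)
    _ = (∫⁻ t, c t ∂ρ) * ∫⁻ t, (c t)⁻¹ * ∫⁻ y, φ t y ^ 2 ∂ν ∂ρ := by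
        rw [lintegral_const_mul _ hφint, lintegral_lintegral_swap
          (f := fun y t => (c t)⁻¹ * φ t y ^ 2) (hφsq.comp measurable_swap).aemeasurable]
        congr! 3 with t
        exact lintegral_const_mul _ ((hφ.comp measurable_prodMk_left).pow_const 2)
    _ ≤ (∫⁻ t, c t ∂ρ) * ∫⁻ t, c t * ∫⁻ x, f x ^ 2 ∂μ ∂ρ := by
        refine mul_le_mul_right (lintegral_mono_ae (hb.mono fun t ht => ?_)) _
        calc (c t)⁻¹ * ∫⁻ y, φ t y ^ 2 ∂ν ≤ (c t)⁻¹ * (c t ^ 2 * ∫⁻ x, f x ^ 2 ∂μ) := by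
              gcongr
              exact ht f hf
          _ = c t * ∫⁻ x, f x ^ 2 ∂μ := by
              rw [sq, ← mul_assoc, ← mul_assoc, ENNReal.inv_mul_cancel (hc0 t) (hctop t), one_mul]
    _ = (∫⁻ t, c t ∂ρ) ^ 2 * ∫⁻ x, f x ^ 2 ∂μ := by
        rw [lintegral_mul_const _ hc, sq, mul_assoc]

end LintegralKernels

section IntegralOperators

open scoped ComplexConjugate

variable {X Y Z : Type*} [MeasurableSpace X] [MeasurableSpace Y] [MeasurableSpace Z]
  {μ : Measure X} {ν : Measure Y} {ρ : Measure Z}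

theorem lintegral_enorm_coeFn_sq (f : Lp ℂ 2 μ) : ∫⁻ x, ‖f x‖ₑ ^ 2 ∂μ = ‖f‖ₑ ^ 2 := by
  rw [Lp.enorm_def]
  simpa using (eLpNorm_nnreal_pow_eq_lintegral (μ := μ) (f := f) two_ne_zero).symm

theorem measurable_enorm_coeFn (f : Lp ℂ 2 μ) : Measurable fun x => ‖f x‖ₑ :=
  (Lp.stronglyMeasurable f).enorm

section KernelBound

variable {κ : Y → X → ℝ≥0∞} {C : ℝ≥0∞}

theorem KernelBound.lintegral_sq_le (h : KernelBound μ ν κ C) (f : Lp ℂ 2 μ) :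
    ∫⁻ y, (∫⁻ x, κ y x * ‖f x‖ₑ ∂μ) ^ 2 ∂ν ≤ (C * ‖f‖ₑ) ^ 2 := by
  rw [mul_pow, ← lintegral_enorm_coeFn_sq]
  exact h _ (measurable_enorm_coeFn f)

theorem KernelBound.ae_lintegral_lt_top [SFinite μ] (h : KernelBound μ ν κ C) (hC : C ≠ ∞)
    (hκ : Measurable fun z : Y × X => κ z.1 z.2) {f : X → ℝ≥0∞} (hf : Measurable f)
    (hf2 : ∫⁻ x, f x ^ 2 ∂μ ≠ ∞) : ∀ᵐ y ∂ν, ∫⁻ x, κ y x * f x ∂μ < ∞ := by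
  have hfin : ∫⁻ y, (∫⁻ x, κ y x * f x ∂μ) ^ 2 ∂ν ≠ ∞ :=
    ne_top_of_le_ne_top (by finiteness) (h f hf)
  filter_upwards [ae_lt_top ((measurable_lintegral_kernel_mul hκ hf).pow_const 2) hfin] with y hy
  exact (ENNReal.pow_lt_top_iff.1 hy).resolve_right two_ne_zero

theorem KernelBound.lintegral_form_lt_top [SFinite μ] (h : KernelBound μ ν κ C) (hC : C ≠ ∞)
    (hκ : Measurable fun z : Y × X => κ z.1 z.2) (u : Lp ℂ 2 ν) (f : Lp ℂ 2 μ) :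
    ∫⁻ y, (∫⁻ x, κ y x * ‖f x‖ₑ ∂μ) * ‖u y‖ₑ ∂ν < ∞ := by
  have hsq := (sq_lintegral_mul_le (μ := ν)
    (measurable_lintegral_kernel_mul (μ := μ) hκ (measurable_enorm_coeFn f)).aemeasurable
    (measurable_enorm_coeFn u).aemeasurable).trans
      (mul_le_mul_left (h.lintegral_sq_le f) _)
  rw [lintegral_enorm_coeFn_sq] at hsq
  exact (ENNReal.pow_lt_top_iff.1 (hsq.trans_lt (by finiteness))).resolve_right two_ne_zero

end KernelBound

/-- The measurable nonnegative kernel `K` defines an operator from `L²(μ)` to `L²(ν)` of norm at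
most `C`. -/
structure IsBoundedKernel (μ : Measure X) (ν : Measure Y) (K : Y → X → ℝ) (C : ℝ) : Prop where
  measurable : Measurable fun z : Y × X => K z.1 z.2
  nonneg : ∀ y x, 0 ≤ K y x
  kernelBound : KernelBound μ ν (fun y x => ENNReal.ofReal (K y x)) (ENNReal.ofReal C)

namespace IsBoundedKernel

variable {K : Y → X → ℝ} {C : ℝ}

theorem mono_right {C' : ℝ} (hK : IsBoundedKernel μ ν K C) (hC : C ≤ C') :
    IsBoundedKernel μ ν K C' :=
  ⟨hK.measurable, hK.nonneg, hK.kernelBound.mono_right (ENNReal.ofReal_le_ofReal hC)⟩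

theorem const_mul {a : ℝ} (hK : IsBoundedKernel μ ν K C) (ha : 0 ≤ a) :
    IsBoundedKernel μ ν (fun y x => a * K y x) (a * C) where
  measurable := hK.measurable.const_mul a
  nonneg y x := mul_nonneg ha (hK.nonneg y x)
  kernelBound := by
    simpa only [ENNReal.ofReal_mul ha] using hK.kernelBound.const_mul ENNReal.ofReal_ne_top

theorem enorm_mul (hK : IsBoundedKernel μ ν K C) (y : Y) (x : X) (z : ℂ) :
    ‖(K y x : ℂ) * z‖ₑ = ENNReal.ofReal (K y x) * ‖z‖ₑ := by
  rw [_root_.enorm_mul, ← ofReal_norm (K y x : ℂ), Complex.norm_real,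
    Real.norm_of_nonneg (hK.nonneg y x)]

theorem stronglyMeasurable_mul (hK : IsBoundedKernel μ ν K C) (f : Lp ℂ 2 μ) :
    StronglyMeasurable fun z : Y × X => (K z.1 z.2 : ℂ) * f z.2 :=
  (Complex.measurable_ofReal.comp hK.measurable).stronglyMeasurable.mul
    ((Lp.stronglyMeasurable f).comp_measurable measurable_snd)

theorem ae_integrable [SFinite μ] (hK : IsBoundedKernel μ ν K C) (f : Lp ℂ 2 μ) :
    ∀ᵐ y ∂ν, Integrable (fun x => (K y x : ℂ) * f x) μ := by
  filter_upwards [hK.kernelBound.ae_lintegral_lt_top ENNReal.ofReal_ne_top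
    hK.measurable.ennreal_ofReal (measurable_enorm_coeFn f)
    (by rw [lintegral_enorm_coeFn_sq]; finiteness)] with y hy
  refine ⟨((hK.stronglyMeasurable_mul f).comp_measurable
    measurable_prodMk_left).aestronglyMeasurable, ?_⟩
  simpa only [hasFiniteIntegral_iff_enorm, hK.enorm_mul] using hy

theorem eLpNorm_integral_le (hK : IsBoundedKernel μ ν K C) (f : Lp ℂ 2 μ) :
    eLpNorm (fun y => ∫ x, (K y x : ℂ) * f x ∂μ) 2 ν ≤ ENNReal.ofReal C * ‖f‖ₑ := by
  refine (ENNReal.pow_le_pow_left_iff two_ne_zero).1 ?_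
  calc eLpNorm (fun y => ∫ x, (K y x : ℂ) * f x ∂μ) 2 ν ^ 2
      = ∫⁻ y, ‖∫ x, (K y x : ℂ) * f x ∂μ‖ₑ ^ 2 ∂ν := by
        simpa using eLpNorm_nnreal_pow_eq_lintegral (μ := ν)
          (f := fun y => ∫ x, (K y x : ℂ) * f x ∂μ) two_ne_zero
    _ ≤ ∫⁻ y, (∫⁻ x, ENNReal.ofReal (K y x) * ‖f x‖ₑ ∂μ) ^ 2 ∂ν := by
        simp only [← hK.enorm_mul]
        gcongr
        exact enorm_integral_le_lintegral_enorm _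
    _ ≤ (ENNReal.ofReal C * ‖f‖ₑ) ^ 2 := hK.kernelBound.lintegral_sq_le f

theorem memLp_integral [SFinite μ] (hK : IsBoundedKernel μ ν K C) (f : Lp ℂ 2 μ) :
    MemLp (fun y => ∫ x, (K y x : ℂ) * f x ∂μ) 2 ν :=
  ⟨(hK.stronglyMeasurable_mul f).integral_prod_right'.aestronglyMeasurable,
    (hK.eLpNorm_integral_le f).trans_lt (by finiteness)⟩

theorem exists_isIntegralOperator [SFinite μ] (hK : IsBoundedKernel μ ν K C) (hC : 0 ≤ C) :
    ∃ T : Lp ℂ 2 μ →L[ℂ] Lp ℂ 2 ν, IsIntegralOperator T K ∧ ‖T‖ ≤ C := by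
  let L : Lp ℂ 2 μ →ₗ[ℂ] Lp ℂ 2 ν :=
    { toFun f := (hK.memLp_integral f).toLp _
      map_add' f g := by
        rw [← MemLp.toLp_add]
        refine MemLp.toLp_congr _ _ ?_
        filter_upwards [hK.ae_integrable f, hK.ae_integrable g] with y hf hg
        rw [Pi.add_apply, ← integral_add hf hg]
        refine integral_congr_ae ?_
        filter_upwards [Lp.coeFn_add f g] with x hx
        rw [hx, Pi.add_apply, mul_add]
      map_smul' a f := by
        rw [RingHom.id_apply, ← MemLp.toLp_const_smul]
        refine MemLp.toLp_congr _ _ (.of_forall fun y => ?_)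
        rw [Pi.smul_apply, smul_eq_mul, ← integral_const_mul]
        refine integral_congr_ae ?_
        filter_upwards [Lp.coeFn_smul a f] with x hx
        rw [hx, Pi.smul_apply, smul_eq_mul, mul_left_comm] }
  have hL : ∀ f, ‖L f‖ ≤ C * ‖f‖ := fun f => by
    have h : ‖L f‖ₑ ≤ ENNReal.ofReal C * ‖f‖ₑ :=
      (Lp.enorm_toLp (hK.memLp_integral f)).trans_le (hK.eLpNorm_integral_le f)
    rwa [← ofReal_norm, ← ofReal_norm, ← ENNReal.ofReal_mul hC,
      ENNReal.ofReal_le_ofReal_iff (by positivity)] at h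
  exact ⟨L.mkContinuous C hL, fun f => ⟨hK.ae_integrable f, (hK.memLp_integral f).coeFn_toLp⟩,
    L.mkContinuous_norm_le hC hL⟩

end IsBoundedKernel

/-- The bounded operator with kernel `K`, or zero if there is none. -/
def integralOperator (μ : Measure X) (ν : Measure Y) (K : Y → X → ℝ) : Lp ℂ 2 μ →L[ℂ] Lp ℂ 2 ν :=
  open Classical in
  if h : ∃ T : Lp ℂ 2 μ →L[ℂ] Lp ℂ 2 ν, IsIntegralOperator T K then h.choose else 0

namespace IsBoundedKernel

variable {K : Y → X → ℝ} {C : ℝ}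

theorem isIntegralOperator [SFinite μ] (hK : IsBoundedKernel μ ν K C) (hC : 0 ≤ C) :
    IsIntegralOperator (integralOperator μ ν K) K := by
  have hex : ∃ T : Lp ℂ 2 μ →L[ℂ] Lp ℂ 2 ν, IsIntegralOperator T K :=
    (hK.exists_isIntegralOperator hC).imp fun _ h => h.1
  rw [integralOperator, dif_pos hex]
  exact hex.choose_spec

theorem norm_integralOperator_le [SFinite μ] (hK : IsBoundedKernel μ ν K C) (hC : 0 ≤ C) :
    ‖integralOperator μ ν K‖ ≤ C := by
  obtain ⟨T, hT, hTC⟩ := hK.exists_isIntegralOperator hC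
  rwa [(hK.isIntegralOperator hC).unique hT]

theorem integrable_form [SFinite μ] [SFinite ν] (hK : IsBoundedKernel μ ν K C) (u : Lp ℂ 2 ν)
    (f : Lp ℂ 2 μ) :
    Integrable (fun z : Y × X => (K z.1 z.2 : ℂ) * f z.2 * conj (u z.1)) (ν.prod μ) := by
  have hm : StronglyMeasurable fun z : Y × X => (K z.1 z.2 : ℂ) * f z.2 * conj (u z.1) :=
    (hK.stronglyMeasurable_mul f).mul (RCLike.continuous_conj.comp_stronglyMeasurable
      ((Lp.stronglyMeasurable u).comp_measurable measurable_fst))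
  refine ⟨hm.aestronglyMeasurable, ?_⟩
  rw [hasFiniteIntegral_iff_enorm, lintegral_prod _ hm.enorm.aemeasurable]
  simp only [_root_.enorm_mul _ (conj _), RCLike.enorm_conj, hK.enorm_mul,
    lintegral_mul_const' _ _ enorm_ne_top]
  exact hK.kernelBound.lintegral_form_lt_top ENNReal.ofReal_ne_top hK.measurable.ennreal_ofReal u f

end IsBoundedKernel

namespace IsIntegralOperator

variable {K : Y → X → ℝ} {C : ℝ} {T : Lp ℂ 2 μ →L[ℂ] Lp ℂ 2 ν}

theorem inner_eq [SFinite μ] [SFinite ν] (hT : IsIntegralOperator T K)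
    (hK : IsBoundedKernel μ ν K C) (u : Lp ℂ 2 ν) (f : Lp ℂ 2 μ) :
    ⟪u, T f⟫_ℂ = ∫ z : Y × X, (K z.1 z.2 : ℂ) * f z.2 * conj (u z.1) ∂(ν.prod μ) := by
  rw [integral_prod _ (hK.integrable_form u f), L2.inner_def]
  refine integral_congr_ae ?_
  filter_upwards [(hT f).2] with y hy
  rw [RCLike.inner_apply, hy, ← integral_mul_const]

theorem const_smul (hT : IsIntegralOperator T K) (a : ℝ) :
    IsIntegralOperator ((a : ℂ) • T) fun y x => a * K y x := by
  intro f
  simp only [Complex.ofReal_mul, mul_assoc, integral_const_mul]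
  refine ⟨(hT f).1.mono fun y hy => hy.const_mul _, ?_⟩
  filter_upwards [(hT f).2, Lp.coeFn_smul (a : ℂ) (T f)] with y hy hsmul
  rw [smul_apply, hsmul, Pi.smul_apply, hy, smul_eq_mul]

theorem isSelfAdjoint [SFinite μ] {K : X → X → ℝ} {T : Lp ℂ 2 μ →L[ℂ] Lp ℂ 2 μ}
    (hT : IsIntegralOperator T K) (hK : IsBoundedKernel μ μ K C) (hsymm : ∀ x y, K x y = K y x) :
    IsSelfAdjoint T := by
  refine (show T.IsSymmetric from fun f g => ?_).isSelfAdjoint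
  change ⟪T f, g⟫_ℂ = ⟪f, T g⟫_ℂ
  rw [← inner_conj_symm, hT.inner_eq hK, hT.inner_eq hK, ← integral_conj, ← integral_prod_swap]
  refine integral_congr_ae (.of_forall fun z => ?_)
  simp only [Prod.fst_swap, Prod.snd_swap, map_mul, Complex.conj_ofReal, Complex.conj_conj,
    hsymm z.1 z.2]
  ring

theorem ae_integrable_comp [SFinite μ] [SFinite ν] (hK : IsBoundedKernel μ ν K C)
    {K' : Z → Y → ℝ} {C' : ℝ} (hK' : IsBoundedKernel ν ρ K' C') (f : Lp ℂ 2 μ) :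
    ∀ᵐ z ∂ρ, Integrable (fun w : Y × X => (K' z w.1 : ℂ) * ((K w.1 w.2 : ℂ) * f w.2))
      (ν.prod μ) := by
  have hκ := hK.kernelBound.lintegral_sq_le f
  filter_upwards [hK'.kernelBound.ae_lintegral_lt_top ENNReal.ofReal_ne_top
    hK'.measurable.ennreal_ofReal
    (measurable_lintegral_kernel_mul (μ := μ) hK.measurable.ennreal_ofReal
      (measurable_enorm_coeFn f)) (ne_top_of_le_ne_top (by finiteness) hκ)] with z hz
  have hK'z : Measurable fun y => K' z y := hK'.measurable.comp measurable_prodMk_left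
  have hm : StronglyMeasurable fun w : Y × X => (K' z w.1 : ℂ) * ((K w.1 w.2 : ℂ) * f w.2) :=
    (Complex.measurable_ofReal.comp (hK'z.comp measurable_fst)).stronglyMeasurable.mul
      (hK.stronglyMeasurable_mul f)
  refine ⟨hm.aestronglyMeasurable, ?_⟩
  rw [hasFiniteIntegral_iff_enorm, lintegral_prod _ hm.enorm.aemeasurable]
  simpa only [hK'.enorm_mul, hK.enorm_mul, lintegral_const_mul' _ _ ENNReal.ofReal_ne_top] using hz

theorem comp [SFinite μ] [SFinite ν] (hT : IsIntegralOperator T K) (hK : IsBoundedKernel μ ν K C)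
    {K' : Z → Y → ℝ} {C' : ℝ} {T' : Lp ℂ 2 ν →L[ℂ] Lp ℂ 2 ρ} (hT' : IsIntegralOperator T' K')
    (hK' : IsBoundedKernel ν ρ K' C') :
    IsIntegralOperator (T' ∘L T) fun z x => ∫ y, K' z y * K y x ∂ν := by
  intro f
  have hpull : ∀ z x, ((∫ y, K' z y * K y x ∂ν : ℝ) : ℂ) * f x =
      ∫ y, (K' z y : ℂ) * ((K y x : ℂ) * f x) ∂ν := fun z x => by
    simp only [← mul_assoc, integral_mul_const, ← integral_complex_ofReal, Complex.ofReal_mul]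
  simp only [hpull]
  refine ⟨(ae_integrable_comp hK hK' f).mono fun z hz => hz.integral_prod_right, ?_⟩
  filter_upwards [ae_integrable_comp hK hK' f, (hT' (T f)).2] with z hz hT'z
  rw [ContinuousLinearMap.comp_apply, hT'z, ← integral_integral_swap hz]
  refine integral_congr_ae ?_
  filter_upwards [(hT f).2] with y hy
  rw [hy, integral_const_mul]

theorem integrable_mul_conj [SFinite μ] [SFinite ν] (hK : IsBoundedKernel μ ν K C)
    (f : Lp ℂ 2 μ) :
    Integrable (fun w : Y × X × X => (K w.1 w.2.1 : ℂ) * f w.2.1 * conj ((K w.1 w.2.2 : ℂ) *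
      f w.2.2)) (ν.prod (μ.prod μ)) := by
  have hKf := hK.stronglyMeasurable_mul f
  have hm : StronglyMeasurable fun w : Y × X × X =>
      (K w.1 w.2.1 : ℂ) * f w.2.1 * conj ((K w.1 w.2.2 : ℂ) * f w.2.2) :=
    (hKf.comp_measurable (measurable_fst.prodMk (measurable_fst.comp measurable_snd))).mul
      (RCLike.continuous_conj.comp_stronglyMeasurable
        (hKf.comp_measurable (measurable_fst.prodMk (measurable_snd.comp measurable_snd))))
  refine ⟨hm.aestronglyMeasurable, ?_⟩
  rw [hasFiniteIntegral_iff_enorm, lintegral_prod _ hm.enorm.aemeasurable]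
  refine lt_of_le_of_lt (le_of_eq (lintegral_congr fun y => ?_))
    ((hK.kernelBound.lintegral_sq_le f).trans_lt (by finiteness))
  have hKy : Measurable fun x => K y x := hK.measurable.comp measurable_prodMk_left
  have hKfy : AEMeasurable (fun x => ENNReal.ofReal (K y x) * ‖f x‖ₑ) μ :=
    (hKy.ennreal_ofReal.mul (measurable_enorm_coeFn f)).aemeasurable
  rw [sq, ← lintegral_prod_mul hKfy hKfy]
  simp only [_root_.enorm_mul _ (conj _), RCLike.enorm_conj, hK.enorm_mul]

theorem norm_sq_eq [SFinite μ] [SFinite ν] (hT : IsIntegralOperator T K)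
    (hK : IsBoundedKernel μ ν K C) (f : Lp ℂ 2 μ) :
    ((‖T f‖ ^ 2 : ℝ) : ℂ) = ∫ z : X × X, ((∫ y, K y z.1 * K y z.2 ∂ν : ℝ) : ℂ) *
      (f z.1 * conj (f z.2)) ∂(μ.prod μ) := by
  have hnorm : ((‖T f‖ ^ 2 : ℝ) : ℂ) = ⟪T f, T f⟫_ℂ := by
    rw [inner_self_eq_norm_sq_to_K]; simp
  rw [hnorm, L2.inner_def]
  calc ∫ y, ⟪T f y, T f y⟫_ℂ ∂ν
      = ∫ y, ∫ z : X × X, (K y z.1 : ℂ) * f z.1 * conj ((K y z.2 : ℂ) * f z.2) ∂(μ.prod μ) ∂ν := by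
        refine integral_congr_ae ?_
        filter_upwards [(hT f).2] with y hy
        rw [RCLike.inner_apply, hy, ← integral_conj,
          integral_prod_mul (fun x => (K y x : ℂ) * f x) fun x => conj ((K y x : ℂ) * f x)]
    _ = ∫ z : X × X, ∫ y, (K y z.1 : ℂ) * f z.1 * conj ((K y z.2 : ℂ) * f z.2) ∂ν ∂(μ.prod μ) :=
        integral_integral_swap (integrable_mul_conj hK f)
    _ = _ := by
        refine integral_congr_ae (.of_forall fun z => ?_)
        simp only [← integral_complex_ofReal, ← integral_mul_const, Complex.ofReal_mul, map_mul,
          Complex.conj_ofReal, mul_mul_mul_comm]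

theorem norm_sq_eq_mul [SFinite μ] [SFinite ν] [SFinite ρ] (hT : IsIntegralOperator T K)
    (hK : IsBoundedKernel μ ν K C) {K' : Z → X → ℝ} {C' : ℝ} {T' : Lp ℂ 2 μ →L[ℂ] Lp ℂ 2 ρ}
    (hT' : IsIntegralOperator T' K') (hK' : IsBoundedKernel μ ρ K' C') {a : ℝ}
    (h : ∀ x x', ∫ y, K y x * K y x' ∂ν = a * ∫ z, K' z x * K' z x' ∂ρ) (f : Lp ℂ 2 μ) :
    ‖T f‖ ^ 2 = a * ‖T' f‖ ^ 2 := by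
  rw [← Complex.ofReal_inj, Complex.ofReal_mul, hT.norm_sq_eq hK, hT'.norm_sq_eq hK',
    ← integral_const_mul]
  simp only [h, Complex.ofReal_mul, mul_assoc]

theorem hilbertSchmidtBound {D : ℝ} (hT : IsIntegralOperator T K)
    (hmem : ∀ y, MemLp (fun x => (K y x : ℂ)) 2 μ) (hD : 0 ≤ D)
    (hle : ∫⁻ y, ∫⁻ x, ‖K y x‖ₑ ^ 2 ∂μ ∂ν ≤ ENNReal.ofReal D) : HilbertSchmidtBound T D := by
  intro n v hv
  set κ : Y → Lp ℂ 2 μ := fun y => (hmem y).toLp _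
  have hκ : ∀ y, ∀ᵐ x ∂μ, κ y x = (K y x : ℂ) := fun y => (hmem y).coeFn_toLp
  have hκ_norm : ∀ y, ‖κ y‖ₑ ^ 2 = ∫⁻ x, ‖K y x‖ₑ ^ 2 ∂μ := fun y => by
    rw [← lintegral_enorm_coeFn_sq]
    refine lintegral_congr_ae ((hκ y).mono fun x hx => ?_)
    simp only [hx, ← ofReal_norm, Complex.norm_real]
  have hTv : ∀ᵐ y ∂ν, ∀ i, T (v i) y = ⟪κ y, v i⟫_ℂ := by
    refine ae_all_iff.2 fun i => ?_
    filter_upwards [(hT (v i)).2] with y hy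
    rw [hy, L2.inner_def]
    refine integral_congr_ae ((hκ y).mono fun x hx => ?_)
    simp only [RCLike.inner_apply, hx, Complex.conj_ofReal, mul_comm]
  have hbessel : ∀ᵐ y ∂ν, ∑ i, ‖T (v i) y‖ₑ ^ 2 ≤ ∫⁻ x, ‖K y x‖ₑ ^ 2 ∂μ := by
    filter_upwards [hTv] with y hy
    rw [← hκ_norm]
    simp only [hy, ← ofReal_norm, norm_inner_symm (κ y), ← ENNReal.ofReal_pow (norm_nonneg _)]
    rw [← ENNReal.ofReal_sum_of_nonneg fun i _ => sq_nonneg _]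
    exact ENNReal.ofReal_le_ofReal (hv.sum_inner_products_le (κ y))
  refine (ENNReal.ofReal_le_ofReal_iff hD).1 (le_trans ?_ hle)
  rw [ENNReal.ofReal_sum_of_nonneg fun i _ => sq_nonneg _]
  simp only [ENNReal.ofReal_pow (norm_nonneg _), ofReal_norm, ← lintegral_enorm_coeFn_sq]
  rw [← lintegral_finsetSum _ fun i _ => (measurable_enorm_coeFn _).pow_const 2]
  exact lintegral_mono_ae hbessel

end IsIntegralOperator

end IntegralOperators

section Superposition

open scoped ComplexConjugate

variable {X Y Z : Type*} [MeasurableSpace X] [MeasurableSpace Y] [MeasurableSpace Z]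
  {μ : Measure X} {ν : Measure Y} {ρ : Measure Z} [SFinite μ] [SFinite ν] [SFinite ρ]
  {k : Z → Y → X → ℝ} {c : Z → ℝ}

theorem kernelBound_lintegral_ofReal (hk : Measurable fun z : Z × Y × X => k z.1 z.2.1 z.2.2)
    (hc : Measurable c) (hc0 : ∀ t, 0 < c t) (hint : Integrable c ρ)
    (hb : ∀ᵐ t ∂ρ, IsBoundedKernel μ ν (k t) (c t)) :
    KernelBound μ ν (fun y x => ∫⁻ t, ENNReal.ofReal (k t y x) ∂ρ)
      (ENNReal.ofReal (∫ t, c t ∂ρ)) := by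
  rw [ofReal_integral_eq_lintegral_ofReal hint (.of_forall fun t => (hc0 t).le)]
  exact kernelBound_lintegral hk.ennreal_ofReal hc.ennreal_ofReal
    (fun t => (ENNReal.ofReal_pos.2 (hc0 t)).ne') (fun t => ENNReal.ofReal_ne_top)
    (hb.mono fun t ht => ht.kernelBound)

theorem IsBoundedKernel.integral (hk : Measurable fun z : Z × Y × X => k z.1 z.2.1 z.2.2)
    (hc : Measurable c) (hc0 : ∀ t, 0 < c t) (hint : Integrable c ρ)
    (hb : ∀ᵐ t ∂ρ, IsBoundedKernel μ ν (k t) (c t)) :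
    IsBoundedKernel μ ν (fun y x => ∫ t, k t y x ∂ρ) (∫ t, c t ∂ρ) where
  measurable := (StronglyMeasurable.integral_prod_right'
    (f := fun w : (Y × X) × Z => k w.2 w.1.1 w.1.2)
    (hk.comp measurable_swap).stronglyMeasurable).measurable
  nonneg y x := integral_nonneg_of_ae (hb.mono fun t ht => ht.nonneg y x)
  kernelBound := by
    refine (kernelBound_lintegral_ofReal hk hc hc0 hint hb).mono fun y x => ?_
    have hkyx : Measurable fun t => k t y x :=
      hk.comp (measurable_id.prodMk (measurable_const (a := (y, x))) :)
    rw [integral_eq_lintegral_of_nonneg_ae (hb.mono fun t ht => ht.nonneg y x)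
      hkyx.aestronglyMeasurable]
    exact ENNReal.ofReal_toReal_le

theorem integrable_form_superposition
    (hk : Measurable fun z : Z × Y × X => k z.1 z.2.1 z.2.2)
    (hc : Measurable c) (hc0 : ∀ t, 0 < c t) (hint : Integrable c ρ)
    (hb : ∀ᵐ t ∂ρ, IsBoundedKernel μ ν (k t) (c t)) (u : Lp ℂ 2 ν) (f : Lp ℂ 2 μ) :
    Integrable (fun w : (Y × X) × Z => (k w.2 w.1.1 w.1.2 : ℂ) * (f w.1.2 * conj (u w.1.1)))
      ((ν.prod μ).prod ρ) := by
  have hkswap : Measurable fun w : (Y × X) × Z => k w.2 w.1.1 w.1.2 := hk.comp measurable_swap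
  have hm : StronglyMeasurable fun w : (Y × X) × Z =>
      (k w.2 w.1.1 w.1.2 : ℂ) * (f w.1.2 * conj (u w.1.1)) :=
    (Complex.measurable_ofReal.comp hkswap).stronglyMeasurable.mul
      (((Lp.stronglyMeasurable f).comp_measurable (measurable_snd.comp measurable_fst)).mul
        (RCLike.continuous_conj.comp_stronglyMeasurable
          ((Lp.stronglyMeasurable u).comp_measurable (measurable_fst.comp measurable_fst))))
  have hκ : Measurable fun z : Y × X => ∫⁻ t, ENNReal.ofReal (k t z.1 z.2) ∂ρ :=
    hkswap.ennreal_ofReal.lintegral_prod_right'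
  have hfiber : ∀ z : Y × X, ∫⁻ t, ‖(k t z.1 z.2 : ℂ) * (f z.2 * conj (u z.1))‖ₑ ∂ρ =
      (∫⁻ t, ENNReal.ofReal (k t z.1 z.2) ∂ρ) * ‖f z.2‖ₑ * ‖u z.1‖ₑ := fun z => by
    rw [mul_assoc, ← lintegral_mul_const' _ _ (by finiteness)]
    refine lintegral_congr_ae (hb.mono fun t ht => ?_)
    simp only [ht.enorm_mul, enorm_mul (f z.2), RCLike.enorm_conj]
  have hm₂ : Measurable fun z : Y × X =>
      (∫⁻ t, ENNReal.ofReal (k t z.1 z.2) ∂ρ) * ‖f z.2‖ₑ * ‖u z.1‖ₑ :=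
    (hκ.mul ((measurable_enorm_coeFn f).comp measurable_snd)).mul
      ((measurable_enorm_coeFn u).comp measurable_fst)
  refine ⟨hm.aestronglyMeasurable, ?_⟩
  rw [hasFiniteIntegral_iff_enorm, lintegral_prod _ hm.enorm.aemeasurable]
  simp only [hfiber]
  rw [lintegral_prod _ hm₂.aemeasurable]
  simp only [lintegral_mul_const' _ _ enorm_ne_top]
  exact (kernelBound_lintegral_ofReal hk hc hc0 hint hb).lintegral_form_lt_top
    ENNReal.ofReal_ne_top hκ u f

theorem IsIntegralOperator.inner_eq_integral {T : Lp ℂ 2 μ →L[ℂ] Lp ℂ 2 ν}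
    (hT : IsIntegralOperator T fun y x => ∫ t, k t y x ∂ρ) {S : Z → Lp ℂ 2 μ →L[ℂ] Lp ℂ 2 ν}
    (hS : ∀ᵐ t ∂ρ, IsIntegralOperator (S t) (k t))
    (hk : Measurable fun z : Z × Y × X => k z.1 z.2.1 z.2.2)
    (hc : Measurable c) (hc0 : ∀ t, 0 < c t) (hint : Integrable c ρ)
    (hb : ∀ᵐ t ∂ρ, IsBoundedKernel μ ν (k t) (c t)) (u : Lp ℂ 2 ν) (f : Lp ℂ 2 μ) :
    ⟪u, T f⟫_ℂ = ∫ t, ⟪u, S t f⟫_ℂ ∂ρ := by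
  rw [hT.inner_eq (.integral hk hc hc0 hint hb)]
  simp only [← integral_complex_ofReal, mul_assoc, ← integral_mul_const]
  rw [integral_integral_swap (integrable_form_superposition hk hc hc0 hint hb u f)]
  refine integral_congr_ae ?_
  filter_upwards [hS, hb] with t hSt hbt
  simp only [hSt.inner_eq hbt, mul_assoc]

theorem exists_laplace_isIntegralOperator {k : ℝ → Y → X → ℝ}
    (hk : Measurable fun z : ℝ × Y × X => k z.1 z.2.1 z.2.2)
    {S : ℝ → Lp ℂ 2 μ →L[ℂ] Lp ℂ 2 ν} (hS : ∀ t, 0 < t → IsIntegralOperator (S t) (k t))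
    {c : ℝ → ℝ} (hc : Measurable c) (hc0 : ∀ t, 0 < c t)
    (hb : ∀ t, 0 < t → IsBoundedKernel μ ν (k t) (c t)) {lam : ℝ}
    (hint : IntegrableOn (fun t => Real.exp (-lam * t) * c t) (Set.Ioi 0)) :
    ∃ G : Lp ℂ 2 μ →L[ℂ] Lp ℂ 2 ν,
      IsIntegralOperator G (fun y x => ∫ t in Set.Ioi (0 : ℝ), Real.exp (-lam * t) * k t y x) ∧
      IsWeakLaplaceTransform lam S G := by
  have hexp : Measurable fun t : ℝ => Real.exp (-lam * t) := by fun_prop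
  have hke : Measurable fun z : ℝ × Y × X => Real.exp (-lam * z.1) * k z.1 z.2.1 z.2.2 :=
    (hexp.comp measurable_fst).mul hk
  have hce : ∀ t, 0 < Real.exp (-lam * t) * c t := fun t => mul_pos (Real.exp_pos _) (hc0 t)
  have hbe : ∀ᵐ t ∂volume.restrict (Set.Ioi (0 : ℝ)), IsBoundedKernel μ ν
      (fun y x => Real.exp (-lam * t) * k t y x) (Real.exp (-lam * t) * c t) :=
    (ae_restrict_mem measurableSet_Ioi).mono fun t ht => (hb t ht).const_mul (Real.exp_pos _).le
  have hSe : ∀ᵐ t ∂volume.restrict (Set.Ioi (0 : ℝ)), IsIntegralOperator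
      ((Real.exp (-lam * t) : ℂ) • S t) (fun y x => Real.exp (-lam * t) * k t y x) :=
    (ae_restrict_mem measurableSet_Ioi).mono fun t ht => (hS t ht).const_smul _
  obtain ⟨G, hG, -⟩ := (IsBoundedKernel.integral hke (hexp.mul hc) hce hint
    hbe).exists_isIntegralOperator (integral_nonneg fun t => (hce t).le)
  refine ⟨G, hG, fun u f => ?_⟩
  rw [hG.inner_eq_integral hSe hke (hexp.mul hc) hce hint hbe]
  simp only [smul_apply, inner_smul_right]

end Superposition

section Gaussian

variable {E : Type*} [NormedAddCommGroup E] [InnerProductSpace ℝ E]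

/-- Half the dimension of `E`, the exponent to which constants appear in Gaussian integrals. -/
abbrev halfDim (E : Type*) [NormedAddCommGroup E] [InnerProductSpace ℝ E] : ℝ :=
  Module.finrank ℝ E / 2

/-- The Gaussian kernel `κ ^ (d / 2) * exp (-p |x|² - q |y|² + 2 r x · y)` on a space of
dimension `d`. Constants are kept in the base of the power `d / 2`, where they compose like the
exponents; the absolute value makes the kernel nonnegative for every `κ`. -/
def gaussKernel (κ p q r : ℝ) (x y : E) : ℝ :=
  |κ| ^ halfDim E * Real.exp (-p * ‖x‖ ^ 2 - q * ‖y‖ ^ 2 + 2 * r * ⟪x, y⟫_ℝ)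

variable {κ p q r κ' p' q' r' : ℝ}

theorem gaussKernel_nonneg (κ p q r : ℝ) (x y : E) : 0 ≤ gaussKernel κ p q r x y := by
  unfold gaussKernel; positivity

theorem gaussKernel_swap (x y : E) : gaussKernel κ p q r y x = gaussKernel κ q p r x y := by
  unfold gaussKernel
  rw [real_inner_comm]
  congr 2
  ring

theorem gaussKernel_mul (x y : E) :
    gaussKernel κ p q r x y * gaussKernel κ' p' q' r' x y =
      gaussKernel (κ * κ') (p + p') (q + q') (r + r') x y := by
  unfold gaussKernel
  rw [abs_mul, Real.mul_rpow (abs_nonneg _) (abs_nonneg _), mul_mul_mul_comm, ← Real.exp_add]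
  congr 2
  ring

theorem enorm_gaussKernel_sq (x y : E) : ‖gaussKernel κ p q r x y‖ₑ ^ 2 =
    ENNReal.ofReal (gaussKernel (κ * κ) (p + p) (q + q) (r + r) x y) := by
  rw [← gaussKernel_mul, Real.enorm_of_nonneg (gaussKernel_nonneg κ p q r x y),
    ENNReal.ofReal_mul (gaussKernel_nonneg κ p q r x y), sq]

theorem gaussKernel_eq_rpow_mul {c d : ℝ} (hc : 0 ≤ c) (hd : 0 < d) (x y : E) :
    gaussKernel c p q r x y = (c / d) ^ halfDim E * gaussKernel d p q r x y := by
  unfold gaussKernel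
  rw [abs_of_nonneg hc, abs_of_pos hd, ← mul_assoc, ← Real.mul_rpow (by positivity) hd.le,
    div_mul_cancel₀ c hd.ne']

theorem gaussKernel_mul_gaussKernel_eq (x y z : E) :
    gaussKernel κ p q r x y * gaussKernel κ' p' q' r' y z =
      |κ| ^ halfDim E * |κ'| ^ halfDim E * Real.exp (-p * ‖x‖ ^ 2 - q' * ‖z‖ ^ 2) *
        Real.exp (-(q + p') * ‖y‖ ^ 2 + 2 * ⟪r • x + r' • z, y⟫_ℝ) := by
  unfold gaussKernel
  rw [mul_mul_mul_comm, ← Real.exp_add, mul_assoc (_ * _), ← Real.exp_add, inner_add_left,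
    real_inner_smul_left, real_inner_smul_left, real_inner_comm y z]
  congr 2
  ring

section Measurability

variable [MeasurableSpace E] [OpensMeasurableSpace E] [SecondCountableTopology E]

theorem measurable_gaussKernel_comp {Z : Type*} [MeasurableSpace Z] {κ p q r : Z → ℝ} {x y : Z → E}
    (hκ : Measurable κ) (hp : Measurable p) (hq : Measurable q) (hr : Measurable r)
    (hx : Measurable x) (hy : Measurable y) :
    Measurable fun z => gaussKernel (κ z) (p z) (q z) (r z) (x z) (y z) :=
  (hκ.abs.pow_const _).mul (Real.measurable_exp.comp (((hp.neg.mul (hx.norm.pow_const 2)).sub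
    (hq.mul (hy.norm.pow_const 2))).add ((hr.const_mul 2).mul (hx.inner hy))))

theorem measurable_gaussKernel (κ p q r : ℝ) :
    Measurable fun z : E × E => gaussKernel κ p q r z.1 z.2 :=
  measurable_gaussKernel_comp measurable_const measurable_const measurable_const measurable_const
    measurable_fst measurable_snd

end Measurability

variable [FiniteDimensional ℝ E] [MeasurableSpace E] [BorelSpace E]

theorem integral_exp_neg_mul_sq_norm_add {σ : ℝ} (hσ : 0 < σ) (w : E) :
    ∫ v : E, Real.exp (-σ * ‖v‖ ^ 2 + 2 * ⟪w, v⟫_ℝ) =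
      (Real.pi / σ) ^ halfDim E * Real.exp (‖w‖ ^ 2 / σ) := by
  have h := GaussianFourier.integral_cexp_neg_mul_sq_norm_add (b := (σ : ℂ)) (by simpa using hσ) 2 w
  have hσ0 : (σ : ℂ) ≠ 0 := by exact_mod_cast hσ.ne'
  rw [← Complex.ofReal_inj, ← integral_complex_ofReal]
  push_cast
  rw [h, Complex.ofReal_cpow (by positivity)]
  congr 1
  · push_cast; rfl
  · congr 1
    field_simp
    ring

theorem integral_gaussKernel_mul (h : 0 < q + p') (x z : E) :
    ∫ y, gaussKernel κ p q r x y * gaussKernel κ' p' q' r' y z =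
      gaussKernel (κ * κ' * (Real.pi / (q + p'))) (p - r ^ 2 / (q + p')) (q' - r' ^ 2 / (q + p'))
        (r * r' / (q + p')) x z := by
  have hnorm : ‖r • x + r' • z‖ ^ 2 =
      r ^ 2 * ‖x‖ ^ 2 + 2 * (r * r' * ⟪x, z⟫_ℝ) + r' ^ 2 * ‖z‖ ^ 2 := by
    rw [norm_add_sq_real, real_inner_smul_left, real_inner_smul_right, norm_smul, norm_smul,
      mul_pow, mul_pow, Real.norm_eq_abs, Real.norm_eq_abs, sq_abs, sq_abs, mul_assoc r]
  have hexp : Real.exp (-p * ‖x‖ ^ 2 - q' * ‖z‖ ^ 2) * Real.exp (‖r • x + r' • z‖ ^ 2 / (q + p')) =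
      Real.exp (-(p - r ^ 2 / (q + p')) * ‖x‖ ^ 2 - (q' - r' ^ 2 / (q + p')) * ‖z‖ ^ 2 +
        2 * (r * r' / (q + p')) * ⟪x, z⟫_ℝ) := by
    rw [← Real.exp_add, hnorm]
    congr 1
    field_simp
    ring
  simp only [gaussKernel_mul_gaussKernel_eq, integral_const_mul, integral_exp_neg_mul_sq_norm_add h]
  rw [gaussKernel, ← hexp, abs_mul, abs_mul, abs_of_pos (div_pos Real.pi_pos h),
    Real.mul_rpow (by positivity) (by positivity), Real.mul_rpow (by positivity) (by positivity)]
  ring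

theorem integral_gaussKernel (hq : 0 < q) (x : E) :
    ∫ y, gaussKernel κ p q r x y =
      |κ * (Real.pi / q)| ^ halfDim E * Real.exp (-(p - r ^ 2 / q) * ‖x‖ ^ 2) := by
  have h := integral_gaussKernel_mul (κ := κ) (p := p) (q := q) (r := r) (κ' := 1) (p' := 0)
    (q' := 0) (r' := 0) (by simpa using hq) x 0
  simpa [gaussKernel] using h

theorem integrable_gaussKernel (hq : 0 < q) (x : E) : Integrable (gaussKernel κ p q r x) := by
  rcases eq_or_ne (|κ| ^ halfDim E) 0 with hκ | hκ
  · have hzero : gaussKernel κ p q r x = 0 := funext fun y => by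
      rw [gaussKernel, hκ, zero_mul, Pi.zero_apply]
    exact hzero ▸ integrable_zero _ _ _
  · refine .of_integral_ne_zero ?_
    rw [integral_gaussKernel hq, abs_mul, Real.mul_rpow (abs_nonneg _) (abs_nonneg _)]
    exact mul_ne_zero (mul_ne_zero hκ
      (Real.rpow_pos_of_pos (abs_pos.2 (div_pos Real.pi_pos hq).ne') _).ne') (Real.exp_ne_zero _)

theorem lintegral_gaussKernel (hq : 0 < q) (x : E) :
    ∫⁻ y, ENNReal.ofReal (gaussKernel κ p q r x y) = ENNReal.ofReal
      (|κ * (Real.pi / q)| ^ halfDim E * Real.exp (-(p - r ^ 2 / q) * ‖x‖ ^ 2)) := by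
  rw [← integral_gaussKernel hq, ofReal_integral_eq_lintegral_ofReal (integrable_gaussKernel hq x)
    (.of_forall fun y => gaussKernel_nonneg _ _ _ _ _ _)]

theorem lintegral_gaussKernel_le (hq : 0 < q) (hr : r ^ 2 ≤ p * q) (x : E) :
    ∫⁻ y, ENNReal.ofReal (gaussKernel κ p q r x y) ≤
      ENNReal.ofReal (|κ * (Real.pi / q)| ^ halfDim E) := by
  have hp : 0 ≤ p - r ^ 2 / q := sub_nonneg.2 ((div_le_iff₀ hq).2 hr)
  rw [lintegral_gaussKernel hq]
  refine ENNReal.ofReal_le_ofReal (mul_le_of_le_one_right (by positivity) ?_)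
  rw [Real.exp_le_one_iff, neg_mul, neg_nonpos]
  positivity

theorem isBoundedKernel_gaussKernel {m : ℝ} (hm : 0 < m) (hp : m ≤ p) (hq : m ≤ q)
    (hr : r ^ 2 ≤ p * q) :
    IsBoundedKernel volume volume (gaussKernel κ p q r : E → E → ℝ)
      (|κ * (Real.pi / m)| ^ halfDim E) where
  measurable := measurable_gaussKernel κ p q r
  nonneg := gaussKernel_nonneg κ p q r
  kernelBound := by
    have hmono : ∀ s, m ≤ s →
        |κ * (Real.pi / s)| ^ halfDim E ≤ |κ * (Real.pi / m)| ^ halfDim E := fun s hs => by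
      rw [abs_mul, abs_mul, abs_of_pos (div_pos Real.pi_pos hm),
        abs_of_pos (div_pos Real.pi_pos (hm.trans_le hs))]
      have hs0 : 0 < s := hm.trans_le hs
      gcongr
    refine kernelBound_of_schur (measurable_gaussKernel κ p q r).ennreal_ofReal (fun x => ?_)
      fun y => ?_
    · exact (lintegral_gaussKernel_le (hm.trans_le hq) hr x).trans
        (ENNReal.ofReal_le_ofReal (hmono q hq))
    · simp only [gaussKernel_swap y]
      exact (lintegral_gaussKernel_le (hm.trans_le hp) (by rwa [mul_comm]) y).trans
        (ENNReal.ofReal_le_ofReal (hmono p hp))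

theorem memLp_gaussKernel (hq : 0 < q) (x : E) :
    MemLp (fun y => (gaussKernel κ p q r x y : ℂ)) 2 := by
  have hmeas : Measurable fun y => gaussKernel κ p q r x y :=
    measurable_gaussKernel_comp measurable_const measurable_const measurable_const measurable_const
      measurable_const measurable_id
  have hmem : MemLp (fun y => gaussKernel κ p q r x y) 2 := by
    refine ⟨hmeas.aestronglyMeasurable,
      (eLpNorm_lt_top_iff_lintegral_rpow_enorm_lt_top two_ne_zero ENNReal.ofNat_ne_top).2 ?_⟩
    simp only [ENNReal.toReal_ofNat, ENNReal.rpow_ofNat, enorm_gaussKernel_sq,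
      lintegral_gaussKernel (add_pos hq hq), ENNReal.ofReal_lt_top]
  exact hmem.ofReal

theorem lintegral_lintegral_enorm_gaussKernel_sq (hq : 0 < q)
    (hr : 0 < p + p - (r + r) ^ 2 / (q + q)) :
    ∫⁻ x : E, ∫⁻ y : E, ‖gaussKernel κ p q r x y‖ₑ ^ 2 = ENNReal.ofReal
      (|κ * κ * (Real.pi / (q + q)) * (Real.pi / (p + p - (r + r) ^ 2 / (q + q)))| ^
        halfDim E) := by
  have hinner : ∀ x : E, ∫⁻ y : E, ‖gaussKernel κ p q r x y‖ₑ ^ 2 = ENNReal.ofReal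
      (gaussKernel (κ * κ * (Real.pi / (q + q))) 0 (p + p - (r + r) ^ 2 / (q + q)) 0 0 x) :=
    fun x => by
      simp only [enorm_gaussKernel_sq, lintegral_gaussKernel (add_pos hq hq)]
      rw [gaussKernel, norm_zero, inner_zero_left]
      ring_nf
  simp only [hinner, lintegral_gaussKernel hr]
  simp

/-- The kernel `exp (-2 β |z - x|²) exp (-a |x|²)`. The operator `R` it defines is a factor of every
operator `A` with kernel proportional to `exp (-a |x|²) exp (-β |x - x'|²) exp (-a |x'|²)`, in the
form `R* R = c A`. -/
def dampedGaussKernel (a β : ℝ) (z x : E) : ℝ :=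
  gaussKernel 1 (2 * β) (2 * β + a) (2 * β) z x

theorem isBoundedKernel_dampedGaussKernel {a β : ℝ} (ha : 0 ≤ a) (hβ : 0 < β) :
    IsBoundedKernel volume volume (dampedGaussKernel a β : E → E → ℝ)
      (|1 * (Real.pi / (2 * β))| ^ halfDim E) :=
  isBoundedKernel_gaussKernel (by positivity) le_rfl (by linarith)
    (by nlinarith [mul_nonneg hβ.le ha])

theorem integral_dampedGaussKernel_mul (a : ℝ) {β : ℝ} (hβ : 0 < β) (x x' : E) :
    ∫ z, dampedGaussKernel a β z x * dampedGaussKernel a β z x' =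
      gaussKernel (Real.pi / (4 * β)) (a + β) (a + β) β x x' := by
  simp only [dampedGaussKernel, gaussKernel_swap x]
  rw [integral_gaussKernel_mul (by positivity)]
  congr 1 <;> (field_simp; ring)

theorem integral_gaussKernel_mul_dampedGaussKernel (a : ℝ) {b b' : ℝ} (hb : 0 < b) (hbb' : b < b')
    (z x : E) :
    ∫ y, gaussKernel (2 * b' ^ 2 / (b' - b) / Real.pi) (2 * b * b' / (b' - b))
      (2 * b * b' / (b' - b)) (2 * b * b' / (b' - b)) z y * dampedGaussKernel a b' y x =
        dampedGaussKernel a b z x := by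
  have hb' : 0 < b' := hb.trans hbb'
  have hsub : 0 < b' - b := sub_pos.2 hbb'
  have hsum : 2 * b * b' / (b' - b) + 2 * b' = 2 * b' ^ 2 / (b' - b) := by field_simp; ring
  simp only [dampedGaussKernel]
  rw [integral_gaussKernel_mul (by positivity), hsum]
  congr 1 <;> field_simp
  ring

/- The operator with kernel `exp (-2 b |z - x|²) exp (-a |x|²)` is that with `b'` in place of `b`
followed by convolution with a Gaussian, which costs only a constant. -/
theorem norm_dampedGauss_le {a b b' : ℝ} (ha : 0 ≤ a) (hb : 0 < b) (hbb' : b < b')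
    (f : Lp ℂ 2 (volume : Measure E)) :
    ‖integralOperator volume (volume : Measure E) (dampedGaussKernel a b) f‖ ≤
      (b' / b) ^ halfDim E *
        ‖integralOperator volume (volume : Measure E) (dampedGaussKernel a b') f‖ := by
  have hb' : 0 < b' := hb.trans hbb'
  have hsub : 0 < b' - b := sub_pos.2 hbb'
  have hR : ∀ β, 0 < β → IsIntegralOperator
      (integralOperator volume (volume : Measure E) (dampedGaussKernel a β))
      (dampedGaussKernel a β) := fun β hβ =>
    (isBoundedKernel_dampedGaussKernel ha hβ).isIntegralOperator (by positivity)
  set s : ℝ := 2 * b * b' / (b' - b) with hs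
  have hs0 : 0 < s := by positivity
  have hN := isBoundedKernel_gaussKernel (E := E) (κ := 2 * b' ^ 2 / (b' - b) / Real.pi) hs0 le_rfl
    le_rfl (sq s).le
  have hcomp := (hR b' hb').comp (isBoundedKernel_dampedGaussKernel ha hb')
    (hN.isIntegralOperator (by positivity)) hN
  simp only [hs, integral_gaussKernel_mul_dampedGaussKernel a hb hbb'] at hcomp
  have hconst : |2 * b' ^ 2 / (b' - b) / Real.pi * (Real.pi / s)| = b' / b := by
    rw [abs_of_pos (by positivity), hs]
    field_simp
  rw [(hR b hb).unique hcomp, ContinuousLinearMap.comp_apply, ← hconst]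
  exact ContinuousLinearMap.le_of_opNorm_le _ (hN.norm_integralOperator_le (by positivity)) _

theorem norm_sq_le_of_gaussKernel {Y Y' : Type*} [MeasurableSpace Y] [MeasurableSpace Y']
    {ν : Measure Y} {ν' : Measure Y'} [SFinite ν] [SFinite ν'] {a b b' : ℝ} (ha : 0 ≤ a)
    (hb : 0 < b) (hbb' : b < b') (hκ : 0 < κ) (hκ' : 0 < κ') {K : Y → E → ℝ} {K' : Y' → E → ℝ}
    {C C' : ℝ} {T : Lp ℂ 2 (volume : Measure E) →L[ℂ] Lp ℂ 2 ν}
    {T' : Lp ℂ 2 (volume : Measure E) →L[ℂ] Lp ℂ 2 ν'}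
    (hT : IsIntegralOperator T K) (hK : IsBoundedKernel volume ν K C)
    (hTT : ∀ x x', ∫ y, K y x * K y x' ∂ν = gaussKernel κ (a + b) (a + b) b x x')
    (hT' : IsIntegralOperator T' K') (hK' : IsBoundedKernel volume ν' K' C')
    (hTT' : ∀ x x', ∫ y, K' y x * K' y x' ∂ν' = gaussKernel κ' (a + b') (a + b') b' x x')
    (f : Lp ℂ 2 (volume : Measure E)) :
    ‖T f‖ ^ 2 ≤ (κ * b' / (κ' * b)) ^ halfDim E * ‖T' f‖ ^ 2 := by
  have hb' : 0 < b' := hb.trans hbb'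
  have hR := isBoundedKernel_dampedGaussKernel (E := E) ha hb
  have hR' := isBoundedKernel_dampedGaussKernel (E := E) ha hb'
  have hnorm : ‖T f‖ ^ 2 = (κ / (Real.pi / (4 * b))) ^ halfDim E *
      ‖integralOperator volume (volume : Measure E) (dampedGaussKernel a b) f‖ ^ 2 :=
    hT.norm_sq_eq_mul hK (hR.isIntegralOperator (by positivity)) hR (fun x x' => by
      rw [hTT, integral_dampedGaussKernel_mul a hb, ← gaussKernel_eq_rpow_mul hκ.le
        (by positivity)]) f
  have hnorm' : ‖integralOperator volume (volume : Measure E) (dampedGaussKernel a b') f‖ ^ 2 =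
      (Real.pi / (4 * b') / κ') ^ halfDim E * ‖T' f‖ ^ 2 :=
    (hR'.isIntegralOperator (by positivity)).norm_sq_eq_mul hR' hT' hK' (fun x x' => by
      rw [hTT', integral_dampedGaussKernel_mul a hb', ← gaussKernel_eq_rpow_mul (by positivity)
        hκ']) f
  have hconst : κ / (Real.pi / (4 * b)) * (b' / b * (b' / b)) * (Real.pi / (4 * b') / κ') =
      κ * b' / (κ' * b) := by
    field_simp
  rw [hnorm, ← hconst, Real.mul_rpow (by positivity) (by positivity),
    Real.mul_rpow (by positivity) (by positivity), Real.mul_rpow (by positivity) (by positivity),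
    mul_assoc, ← hnorm', mul_assoc]
  gcongr
  calc _ ≤ ((b' / b) ^ halfDim E * ‖integralOperator volume (volume : Measure E)
        (dampedGaussKernel a b') f‖) ^ 2 := by
        gcongr
        exact norm_dampedGauss_le ha hb hbb' f
    _ = _ := by ring

end Gaussian

section Kernels

variable {E : Type*} [NormedAddCommGroup E] [InnerProductSpace ℝ E]

/-- The heat kernel of `-Δ / 2`, the integral kernel of `exp (t Δ / 2)`. -/
def heatKernel (t : ℝ) : E → E → ℝ :=
  gaussKernel (1 / (2 * Real.pi * t)) (1 / (2 * t)) (1 / (2 * t)) (1 / (2 * t))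

/-- The Mehler kernel of the harmonic oscillator of frequency `Ω` with ground state energy `0` at
the time `t` with `ν = exp (-Ω t)`. -/
def mehlerKernel (Ω ν : ℝ) : E → E → ℝ :=
  gaussKernel (Ω / (Real.pi * (1 - ν ^ 2))) (Ω * (1 + ν ^ 2) / (2 * (1 - ν ^ 2)))
    (Ω * (1 + ν ^ 2) / (2 * (1 - ν ^ 2))) (Ω * ν / (1 - ν ^ 2))

/-- The kernel of the semigroup `exp (-t H₀)`, where `H₀` is the sum of `-Δ / 2` in the first
variable and the harmonic oscillator of frequency `ω` with ground state energy `0` in the second. -/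
def evolutionKernel (ω t : ℝ) (X X' : E × E) : ℝ :=
  heatKernel t X.1 X'.1 * mehlerKernel ω (Real.exp (-ω * t)) X.2 X'.2

/-- The kernel of `exp (-t H₀)` with the second point on the plane `x = y`. -/
def traceKernel (ω t : ℝ) (X : E × E) (z : E) : ℝ :=
  evolutionKernel ω t X (z, z)

theorem heatKernel_nonneg (t : ℝ) (x y : E) : 0 ≤ heatKernel t x y :=
  gaussKernel_nonneg _ _ _ _ _ _

theorem mehlerKernel_nonneg (Ω ν : ℝ) (x y : E) : 0 ≤ mehlerKernel Ω ν x y :=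
  gaussKernel_nonneg _ _ _ _ _ _

theorem evolutionKernel_nonneg (ω t : ℝ) (X X' : E × E) : 0 ≤ evolutionKernel ω t X X' :=
  mul_nonneg (heatKernel_nonneg _ _ _) (mehlerKernel_nonneg _ _ _ _)

theorem heatKernel_swap (t : ℝ) (x y : E) : heatKernel t y x = heatKernel t x y :=
  gaussKernel_swap _ _

theorem mehlerKernel_swap (Ω ν : ℝ) (x y : E) : mehlerKernel Ω ν y x = mehlerKernel Ω ν x y :=
  gaussKernel_swap _ _

theorem evolutionKernel_swap (ω t : ℝ) (X X' : E × E) :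
    evolutionKernel ω t X' X = evolutionKernel ω t X X' := by
  rw [evolutionKernel, heatKernel_swap, mehlerKernel_swap, evolutionKernel]

section Measurability

variable [MeasurableSpace E] [OpensMeasurableSpace E] [SecondCountableTopology E]

theorem measurable_evolutionKernel (ω : ℝ) :
    Measurable fun z : ℝ × (E × E) × (E × E) => evolutionKernel ω z.1 z.2.1 z.2.2 := by
  unfold evolutionKernel heatKernel mehlerKernel
  refine Measurable.mul ?_ ?_ <;> refine measurable_gaussKernel_comp ?_ ?_ ?_ ?_ ?_ ?_ <;> fun_prop

theorem measurable_traceKernel (ω : ℝ) :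
    Measurable fun z : ℝ × (E × E) × E => traceKernel ω z.1 z.2.1 z.2.2 := by
  have hdiag : Measurable fun z : ℝ × (E × E) × E => (z.1, z.2.1, (z.2.2, z.2.2)) := by fun_prop
  exact ((measurable_evolutionKernel ω).comp hdiag :)

end Measurability

theorem exp_neg_mul_mem_Ioo {ω t : ℝ} (hω : 0 < ω) (ht : 0 < t) :
    Real.exp (-ω * t) ∈ Set.Ioo 0 1 :=
  ⟨Real.exp_pos _, by rw [Real.exp_lt_one_iff, neg_mul, neg_lt_zero]; positivity⟩

variable {Ω ν : ℝ}

theorem one_sub_sq_pos (hν : ν ∈ Set.Ioo (0 : ℝ) 1) : 0 < 1 - ν ^ 2 :=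
  sub_pos.2 (pow_lt_one₀ hν.1.le hν.2 two_ne_zero)

theorem mehler_offDiag_sq_le (hΩ : 0 < Ω) (hν : ν ∈ Set.Ioo (0 : ℝ) 1) :
    (Ω * ν / (1 - ν ^ 2)) ^ 2 ≤
      Ω * (1 + ν ^ 2) / (2 * (1 - ν ^ 2)) * (Ω * (1 + ν ^ 2) / (2 * (1 - ν ^ 2))) := by
  have hν0 := hν.1
  have hsub := one_sub_sq_pos hν
  have hle : 2 * ν ≤ 1 + ν ^ 2 := by nlinarith [sq_nonneg (1 - ν)]
  rw [← sq, ← mul_div_mul_left (Ω * ν) (1 - ν ^ 2) two_ne_zero, mul_left_comm]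
  gcongr

theorem mehler_const_le (E : Type*) [NormedAddCommGroup E] [InnerProductSpace ℝ E] (hΩ : 0 < Ω)
    (hν : ν ∈ Set.Ioo (0 : ℝ) 1) :
    |Ω / (Real.pi * (1 - ν ^ 2)) * (Real.pi / (Ω * (1 + ν ^ 2) / (2 * (1 - ν ^ 2))))| ^ halfDim E
      ≤ 2 ^ halfDim E := by
  have hsub := one_sub_sq_pos hν
  have heq : Ω / (Real.pi * (1 - ν ^ 2)) * (Real.pi / (Ω * (1 + ν ^ 2) / (2 * (1 - ν ^ 2)))) =
      2 / (1 + ν ^ 2) := by field_simp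
  rw [heq, abs_of_pos (by positivity)]
  gcongr
  exact div_le_self zero_le_two (by linarith [sq_nonneg ν])

variable [FiniteDimensional ℝ E] [MeasurableSpace E] [BorelSpace E]

theorem isBoundedKernel_mehlerKernel (hΩ : 0 < Ω) (hν : ν ∈ Set.Ioo (0 : ℝ) 1) :
    IsBoundedKernel volume volume (mehlerKernel Ω ν : E → E → ℝ) (2 ^ halfDim E) := by
  have hsub := one_sub_sq_pos hν
  exact (isBoundedKernel_gaussKernel (by positivity) le_rfl le_rfl
    (mehler_offDiag_sq_le hΩ hν)).mono_right (mehler_const_le E hΩ hν)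

theorem lintegral_heatKernel_le_one {t : ℝ} (ht : 0 < t) (x : E) :
    ∫⁻ y, ENNReal.ofReal (heatKernel t x y) ≤ 1 := by
  have hconst : 1 / (2 * Real.pi * t) * (Real.pi / (1 / (2 * t))) = 1 := by field_simp
  refine (lintegral_gaussKernel_le (by positivity) (sq _).le x).trans_eq ?_
  rw [hconst, abs_one, Real.one_rpow, ENNReal.ofReal_one]

theorem lintegral_mehlerKernel_le (hΩ : 0 < Ω) (hν : ν ∈ Set.Ioo (0 : ℝ) 1) (x : E) :
    ∫⁻ y, ENNReal.ofReal (mehlerKernel Ω ν x y) ≤ ENNReal.ofReal (2 ^ halfDim E) := by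
  have hsub := one_sub_sq_pos hν
  exact (lintegral_gaussKernel_le (by positivity) (mehler_offDiag_sq_le hΩ hν) x).trans
    (ENNReal.ofReal_le_ofReal (mehler_const_le E hΩ hν))

variable {ω t : ℝ}

theorem lintegral_evolutionKernel_le (hω : 0 < ω) (ht : 0 < t) (X : E × E) :
    ∫⁻ X', ENNReal.ofReal (evolutionKernel ω t X X') ≤ ENNReal.ofReal (2 ^ halfDim E) := by
  have hheat : Measurable fun x => ENNReal.ofReal (heatKernel t X.1 x) :=
    ((measurable_gaussKernel _ _ _ _).comp measurable_prodMk_left).ennreal_ofReal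
  have hmehler : Measurable fun y =>
      ENNReal.ofReal (mehlerKernel ω (Real.exp (-ω * t)) X.2 y) :=
    ((measurable_gaussKernel _ _ _ _).comp measurable_prodMk_left).ennreal_ofReal
  simp only [evolutionKernel, ENNReal.ofReal_mul (heatKernel_nonneg _ _ _)]
  rw [Measure.volume_eq_prod, lintegral_prod_mul hheat.aemeasurable hmehler.aemeasurable]
  exact (mul_le_mul' (lintegral_heatKernel_le_one ht _)
    (lintegral_mehlerKernel_le hω (exp_neg_mul_mem_Ioo hω ht) _)).trans_eq (one_mul _)

theorem isBoundedKernel_evolutionKernel (hω : 0 < ω) (ht : 0 < t) :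
    IsBoundedKernel volume volume (evolutionKernel ω t : E × E → E × E → ℝ) (2 ^ halfDim E) := by
  have hm : Measurable fun z : (E × E) × (E × E) => evolutionKernel ω t z.1 z.2 :=
    ((measurable_evolutionKernel (E := E) ω).comp
      ((measurable_const (a := t)).prodMk measurable_id) :)
  refine ⟨hm, evolutionKernel_nonneg ω t, kernelBound_of_schur hm.ennreal_ofReal
    (lintegral_evolutionKernel_le hω ht) fun X' => ?_⟩
  simp only [evolutionKernel_swap ω t X']
  exact lintegral_evolutionKernel_le hω ht X'

theorem integral_heatKernel_mul {s t : ℝ} (hs : 0 < s) (ht : 0 < t) (x z : E) :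
    ∫ y, heatKernel s x y * heatKernel t y z = heatKernel (s + t) x z := by
  unfold heatKernel
  rw [integral_gaussKernel_mul (by positivity)]
  congr 1 <;> field_simp <;> ring

theorem integral_mehlerKernel_mul {ν' : ℝ} (hΩ : 0 < Ω) (hν : ν ∈ Set.Ioo (0 : ℝ) 1)
    (hν' : ν' ∈ Set.Ioo (0 : ℝ) 1) (x z : E) :
    ∫ y, mehlerKernel Ω ν x y * mehlerKernel Ω ν' y z = mehlerKernel Ω (ν * ν') x z := by
  have hsub := one_sub_sq_pos hν
  have hsub' := one_sub_sq_pos hν'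
  have hprod : 0 < 1 - ν ^ 2 * ν' ^ 2 := by
    rw [← mul_pow]
    exact one_sub_sq_pos ⟨mul_pos hν.1 hν'.1,
      mul_lt_one_of_nonneg_of_lt_one_left hν.1.le hν.2 hν'.2.le⟩
  have hsum : Ω * (1 + ν ^ 2) / (2 * (1 - ν ^ 2)) + Ω * (1 + ν' ^ 2) / (2 * (1 - ν' ^ 2)) =
      Ω * (1 - ν ^ 2 * ν' ^ 2) / ((1 - ν ^ 2) * (1 - ν' ^ 2)) := by
    field_simp
    ring
  have hprod0 : 1 - ν' ^ 2 * ν ^ 2 ≠ 0 := by rw [mul_comm]; exact hprod.ne'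
  unfold mehlerKernel
  rw [integral_gaussKernel_mul (by positivity), hsum]
  simp only [mul_pow]
  congr 1 <;> field_simp <;> ring

theorem integral_evolutionKernel_mul {s : ℝ} (hω : 0 < ω) (hs : 0 < s) (ht : 0 < t)
    (X Z : E × E) :
    ∫ Y, evolutionKernel ω s X Y * evolutionKernel ω t Y Z = evolutionKernel ω (s + t) X Z := by
  simp only [evolutionKernel, mul_mul_mul_comm (heatKernel s _ _)]
  rw [Measure.volume_eq_prod,
    integral_prod_mul (fun x => heatKernel s X.1 x * heatKernel t x Z.1)
      (fun y => mehlerKernel ω (Real.exp (-ω * s)) X.2 y *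
        mehlerKernel ω (Real.exp (-ω * t)) y Z.2),
    integral_heatKernel_mul hs ht, integral_mehlerKernel_mul hω (exp_neg_mul_mem_Ioo hω hs)
      (exp_neg_mul_mem_Ioo hω ht), ← Real.exp_add, ← mul_add]

theorem integral_traceKernel_mul (hω : 0 < ω) (ht : 0 < t) (z z' : E) :
    ∫ X, traceKernel ω t X z * traceKernel ω t X z' =
      heatKernel (2 * t) z z' * mehlerKernel ω (Real.exp (-ω * (2 * t))) z z' := by
  simp only [traceKernel, evolutionKernel_swap ω t (z, z)]
  rw [integral_evolutionKernel_mul hω ht ht, ← two_mul, evolutionKernel]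

end Kernels

section Green

theorem image_exp_neg_Ioi {ω : ℝ} (hω : 0 < ω) :
    (fun t => Real.exp (-ω * t)) '' Set.Ioi 0 = Set.Ioo 0 1 := by
  refine Set.Subset.antisymm (Set.image_subset_iff.2 fun t ht => exp_neg_mul_mem_Ioo hω ht) ?_
  rintro ν ⟨h0, h1⟩
  refine ⟨-Real.log ν / ω, div_pos (neg_pos.2 (Real.log_neg h0 h1)) hω, ?_⟩
  change Real.exp (-ω * (-Real.log ν / ω)) = ν
  rw [neg_div, neg_mul_neg, mul_div_cancel₀ _ hω.ne', Real.exp_log h0]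

theorem setIntegral_comp_exp_neg_mul {ω : ℝ} (hω : 0 < ω) (g : ℝ → ℝ) :
    ∫ ν in Set.Ioo (0 : ℝ) 1, g ν =
      ∫ t in Set.Ioi (0 : ℝ), ω * Real.exp (-ω * t) * g (Real.exp (-ω * t)) := by
  have hderiv : ∀ t, HasDerivAt (fun t => Real.exp (-ω * t)) (Real.exp (-ω * t) * -ω) t :=
    fun t => by simpa using ((hasDerivAt_id t).const_mul (-ω)).exp
  have hinj : Function.Injective fun t => Real.exp (-ω * t) :=
    Real.exp_injective.comp (mul_right_injective₀ (neg_ne_zero.2 hω.ne'))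
  rw [← image_exp_neg_Ioi hω, integral_image_eq_integral_abs_deriv_smul measurableSet_Ioi
    (fun t _ => (hderiv t).hasDerivWithinAt) hinj.injOn]
  refine setIntegral_congr_fun measurableSet_Ioi fun t _ => ?_
  rw [mul_neg, abs_neg, abs_of_pos (mul_pos (Real.exp_pos _) hω), smul_eq_mul,
    mul_comm ω]

theorem evolutionKernel_eq {E : Type*} [NormedAddCommGroup E] [InnerProductSpace ℝ E] {ω t : ℝ}
    (hω : 0 < ω) (ht : 0 < t) (X X' : E × E) :
    evolutionKernel ω t X X' =
      (ω ^ 2 / (2 * Real.pi ^ 2 * ((1 - Real.exp (-ω * t) ^ 2) * (ω * t)))) ^ halfDim E *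
        Real.exp (-(ω / 2 * ((1 - Real.exp (-ω * t)) / (1 + Real.exp (-ω * t))) *
            (‖X.2‖ ^ 2 + ‖X'.2‖ ^ 2)) - ω / (2 * (ω * t)) * ‖X.1 - X'.1‖ ^ 2 -
            ω * Real.exp (-ω * t) / (1 - Real.exp (-ω * t) ^ 2) * ‖X.2 - X'.2‖ ^ 2) := by
  have hν := exp_neg_mul_mem_Ioo hω ht
  unfold evolutionKernel heatKernel mehlerKernel gaussKernel
  generalize Real.exp (-ω * t) = ν at *
  have hν0 := hν.1
  have hsub : 0 < 1 - ν := sub_pos.2 hν.2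
  have hsub₂ := one_sub_sq_pos hν
  rw [mul_mul_mul_comm, ← Real.exp_add, ← Real.mul_rpow (abs_nonneg _) (abs_nonneg _), ← abs_mul,
    abs_of_pos (by positivity)]
  congr 2
  · field_simp
  · have hfac : 1 - ν ^ 2 = (1 - ν) * (1 + ν) := by ring
    rw [norm_sub_sq_real, norm_sub_sq_real, hfac]
    field_simp
    ring

theorem halfDim_R3 : halfDim R3 = 3 / 2 := by
  rw [halfDim, finrank_euclideanSpace_fin, Nat.cast_ofNat]

theorem evolution_const_R3 {ω a b : ℝ} (hω : 0 < ω) (ha : 0 < a) (hb : 0 < b) :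
    (ω ^ 2 / (2 * Real.pi ^ 2 * (a * b))) ^ halfDim R3 =
      ω ^ 3 / ((2 : ℝ) ^ (3 / 2 : ℝ) * Real.pi ^ 3) / (a ^ (3 / 2 : ℝ) * b ^ (3 / 2 : ℝ)) := by
  have hsq : ∀ x : ℝ, 0 < x → (x ^ 2) ^ (3 / 2 : ℝ) = x ^ 3 := fun x hx => by
    rw [← Real.rpow_natCast_mul hx.le, ← Real.rpow_natCast x 3]
    norm_num
  rw [halfDim_R3, Real.div_rpow (by positivity) (by positivity),
    Real.mul_rpow (by positivity) (by positivity), Real.mul_rpow (by positivity) (by positivity),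
    Real.mul_rpow ha.le hb.le, hsq ω hω, hsq _ Real.pi_pos, div_div]

theorem greenKernel_eq {ω : ℝ} (hω : 0 < ω) (lam : ℝ) (X X' : R3 × R3) :
    greenKernel ω lam X X' =
      ∫ t in Set.Ioi (0 : ℝ), Real.exp (-lam * t) * evolutionKernel ω t X X' := by
  rw [greenKernel, setIntegral_comp_exp_neg_mul hω, ← integral_const_mul]
  refine setIntegral_congr_fun measurableSet_Ioi fun t ht => ?_
  have hν := exp_neg_mul_mem_Ioo hω ht
  have hsub := one_sub_sq_pos hν
  have hωt : 0 < ω * t := mul_pos hω ht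
  have hlog : Real.log (1 / Real.exp (-ω * t)) = ω * t := by
    rw [one_div, ← Real.exp_neg, Real.log_exp, neg_mul, neg_neg]
  have hpow : Real.exp (-ω * t) ^ (lam / ω - 1) = Real.exp (-lam * t) / Real.exp (-ω * t) := by
    rw [← Real.exp_mul, ← Real.exp_sub]
    congr 1
    field_simp
    ring
  simp only [evolutionKernel_eq hω ht, evolution_const_R3 hω hsub hωt, hlog, hpow]
  field_simp

end Green

section Operators

variable {E : Type*} [NormedAddCommGroup E] [InnerProductSpace ℝ E] [FiniteDimensional ℝ E]
  [MeasurableSpace E] [BorelSpace E]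

/-- The semigroup of the harmonic oscillator of frequency `Ω` with ground state energy `0` on
`L²(E)`, at the time `t` with `ν = exp (-Ω t)`. -/
def mehlerOp (Ω ν : ℝ) : Lp ℂ 2 (volume : Measure E) →L[ℂ] Lp ℂ 2 (volume : Measure E) :=
  integralOperator volume volume (mehlerKernel Ω ν)

/-- The semigroup `exp (-t H₀)` on `L²(E × E)`. -/
def evolutionOp (ω t : ℝ) :
    Lp ℂ 2 (volume : Measure (E × E)) →L[ℂ] Lp ℂ 2 (volume : Measure (E × E)) :=
  integralOperator volume volume (evolutionKernel ω t)

variable {Ω ν : ℝ}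

theorem isIntegralOperator_mehlerOp (hΩ : 0 < Ω) (hν : ν ∈ Set.Ioo (0 : ℝ) 1) :
    IsIntegralOperator (mehlerOp (E := E) Ω ν) (mehlerKernel Ω ν) :=
  (isBoundedKernel_mehlerKernel hΩ hν).isIntegralOperator (by positivity)

theorem norm_mehlerOp_le (hΩ : 0 < Ω) (hν : ν ∈ Set.Ioo (0 : ℝ) 1) :
    ‖mehlerOp (E := E) Ω ν‖ ≤ 2 ^ halfDim E :=
  (isBoundedKernel_mehlerKernel hΩ hν).norm_integralOperator_le (by positivity)

theorem isSelfAdjoint_mehlerOp (hΩ : 0 < Ω) (hν : ν ∈ Set.Ioo (0 : ℝ) 1) :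
    IsSelfAdjoint (mehlerOp (E := E) Ω ν) :=
  (isIntegralOperator_mehlerOp hΩ hν).isSelfAdjoint (isBoundedKernel_mehlerKernel hΩ hν)
    fun x y => mehlerKernel_swap Ω ν y x

theorem mehlerOp_comp_mehlerOp {ν' : ℝ} (hΩ : 0 < Ω) (hν : ν ∈ Set.Ioo (0 : ℝ) 1)
    (hν' : ν' ∈ Set.Ioo (0 : ℝ) 1) :
    mehlerOp (E := E) Ω ν ∘L mehlerOp Ω ν' = mehlerOp Ω (ν * ν') := by
  have hcomp := (isIntegralOperator_mehlerOp (E := E) hΩ hν').comp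
    (isBoundedKernel_mehlerKernel hΩ hν') (isIntegralOperator_mehlerOp hΩ hν)
    (isBoundedKernel_mehlerKernel hΩ hν)
  simp only [integral_mehlerKernel_mul hΩ hν hν'] at hcomp
  exact hcomp.unique (isIntegralOperator_mehlerOp hΩ
    ⟨mul_pos hν.1 hν'.1, mul_lt_one_of_nonneg_of_lt_one_left hν.1.le hν.2 hν'.2.le⟩)

theorem mehlerOp_mehlerOp_pow {ν' : ℝ} (hΩ : 0 < Ω) (hν : ν ∈ Set.Ioo (0 : ℝ) 1)
    (hν' : ν' ∈ Set.Ioo (0 : ℝ) 1) (j : ℕ) (f : Lp ℂ 2 (volume : Measure E)) :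
    mehlerOp Ω ν' ((mehlerOp Ω ν ^ j) f) = mehlerOp Ω (ν' * ν ^ j) f := by
  induction j generalizing f with
  | zero => rw [pow_zero, pow_zero, mul_one]; rfl
  | succ j ih =>
    have hmem : ν' * ν ^ j ∈ Set.Ioo (0 : ℝ) 1 :=
      ⟨mul_pos hν'.1 (pow_pos hν.1 j),
        (mul_le_of_le_one_right hν'.1.le (pow_le_one₀ hν.1.le hν.2.le)).trans_lt hν'.2⟩
    rw [pow_succ, mul_apply_eq_comp, ih, ← ContinuousLinearMap.comp_apply,
      mehlerOp_comp_mehlerOp hΩ hmem hν, pow_succ, mul_assoc]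

theorem hilbertSchmidtBound_mehlerOp (hΩ : 0 < Ω) (hν : ν ∈ Set.Ioo (0 : ℝ) 1) :
    HilbertSchmidtBound (mehlerOp (E := E) Ω ν)
      ((1 / (1 - ν ^ 2)) ^ Module.finrank ℝ E) := by
  have hsub := one_sub_sq_pos hν
  have hdiff : Ω * (1 + ν ^ 2) / (2 * (1 - ν ^ 2)) + Ω * (1 + ν ^ 2) / (2 * (1 - ν ^ 2)) -
      (Ω * ν / (1 - ν ^ 2) + Ω * ν / (1 - ν ^ 2)) ^ 2 /
        (Ω * (1 + ν ^ 2) / (2 * (1 - ν ^ 2)) + Ω * (1 + ν ^ 2) / (2 * (1 - ν ^ 2))) =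
      Ω * (1 - ν ^ 2) / (1 + ν ^ 2) := by
    field_simp
    ring
  have hconst : Ω / (Real.pi * (1 - ν ^ 2)) * (Ω / (Real.pi * (1 - ν ^ 2))) * (Real.pi /
      (Ω * (1 + ν ^ 2) / (2 * (1 - ν ^ 2)) + Ω * (1 + ν ^ 2) / (2 * (1 - ν ^ 2)))) *
        (Real.pi / (Ω * (1 - ν ^ 2) / (1 + ν ^ 2))) = (1 / (1 - ν ^ 2)) ^ 2 := by
    field_simp
    norm_num
  refine (isIntegralOperator_mehlerOp hΩ hν).hilbertSchmidtBound
    (memLp_gaussKernel (by positivity)) (by positivity) (le_of_eq ?_)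
  unfold mehlerKernel
  rw [lintegral_lintegral_enorm_gaussKernel_sq (by positivity) (by rw [hdiff]; positivity), hdiff,
    hconst, abs_of_pos (by positivity), ← Real.rpow_natCast_mul (by positivity), halfDim,
    Nat.cast_ofNat, mul_div_cancel₀ _ two_ne_zero, Real.rpow_natCast]

theorem div_one_add_le_one_sub_exp_neg {u : ℝ} (hu : 0 ≤ u) : u / (1 + u) ≤ 1 - Real.exp (-u) := by
  have hexp : Real.exp (-u) ≤ 1 / (1 + u) := by
    rw [Real.exp_neg, ← one_div]
    exact one_div_le_one_div_of_le (by linarith) (by linarith [Real.add_one_le_exp u])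
  have heq : u / (1 + u) = 1 - 1 / (1 + u) := by field_simp; ring
  linarith

theorem one_div_one_sub_exp_sq_le {r : ℝ} (hr : 1 ≤ r) :
    1 / (1 - Real.exp (-(1 / r)) ^ 2) ≤ 2 * r := by
  have hr0 : 0 < r := zero_lt_one.trans_le hr
  have hlow : 1 / (2 * r) ≤ 1 - Real.exp (-(1 / r)) ^ 2 := calc
    1 / (2 * r) ≤ 1 / r / (1 + 1 / r) := by
      rw [div_div, mul_add, mul_one, mul_one_div_cancel hr0.ne']
      gcongr
      linarith
    _ ≤ 1 - Real.exp (-(1 / r)) := div_one_add_le_one_sub_exp_neg (by positivity)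
    _ ≤ 1 - Real.exp (-(1 / r)) ^ 2 := by
      gcongr
      exact pow_le_of_le_one (Real.exp_pos _).le (Real.exp_le_one_iff.2 (by simpa using hr0.le))
        two_ne_zero
  rw [one_div]
  exact inv_le_of_inv_le₀ (by positivity) (by rwa [← one_div])

theorem norm_mehlerOp_exp_neg_le (hΩ : 0 < Ω) {r : ℝ} (hr : 0 < r)
    {f : Lp ℂ 2 (volume : Measure E)}
    (hf : ∀ j : ℕ, ‖(mehlerOp Ω (Real.exp (-(1 / r))) ^ j) f‖ ≤ Real.exp (-1) ^ j * ‖f‖)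
    {l : ℝ} (hl : 0 < l) :
    ‖mehlerOp Ω (Real.exp (-l)) f‖ ≤ 2 ^ halfDim E * Real.exp 1 * Real.exp (-(r * l)) * ‖f‖ := by
  have hmem : ∀ u : ℝ, 0 < u → Real.exp (-u) ∈ Set.Ioo (0 : ℝ) 1 := fun u hu =>
    ⟨Real.exp_pos _, Real.exp_lt_one_iff.2 (neg_lt_zero.2 hu)⟩
  obtain ⟨j, hj⟩ : ∃ j, ⌈r * l⌉₊ = j + 1 :=
    Nat.exists_eq_succ_of_ne_zero (Nat.ceil_pos.2 (mul_pos hr hl)).ne'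
  have hj_lt : (j : ℝ) < r * l := Nat.lt_ceil.1 (hj ▸ j.lt_succ_self)
  have hj_ge : r * l ≤ j + 1 := by exact_mod_cast hj ▸ Nat.le_ceil (r * l)
  have hrest : 0 < l - j / r := by
    rw [sub_pos, div_lt_iff₀ hr]
    linarith
  have hsplit : Real.exp (-(l - j / r)) * Real.exp (-(1 / r)) ^ j = Real.exp (-l) := by
    rw [← Real.exp_nat_mul, ← Real.exp_add]
    congr 1
    field_simp
    ring
  rw [← hsplit, ← mehlerOp_mehlerOp_pow hΩ (hmem _ (by positivity)) (hmem _ hrest)]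
  calc ‖mehlerOp Ω (Real.exp (-(l - j / r))) ((mehlerOp Ω (Real.exp (-(1 / r))) ^ j) f)‖
      ≤ 2 ^ halfDim E * ‖(mehlerOp Ω (Real.exp (-(1 / r))) ^ j) f‖ :=
        ContinuousLinearMap.le_of_opNorm_le _ (norm_mehlerOp_le hΩ (hmem _ hrest)) _
    _ ≤ 2 ^ halfDim E * (Real.exp (-1) ^ j * ‖f‖) := by
        gcongr
        exact hf j
    _ ≤ 2 ^ halfDim E * (Real.exp (1 + -(r * l)) * ‖f‖) := by
        rw [← Real.exp_nat_mul]
        gcongr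
        linarith
    _ = 2 ^ halfDim E * Real.exp 1 * Real.exp (-(r * l)) * ‖f‖ := by
        rw [Real.exp_add]
        ring

theorem exists_submodule_mehlerOp (hΩ : 0 < Ω) {r : ℝ} (hr : 1 ≤ r) :
    ∃ V : Submodule ℂ (Lp ℂ 2 (volume : Measure E)), FiniteDimensional ℂ V ∧
      Module.finrank ℂ V ≤ Real.exp 2 * (2 * r) ^ Module.finrank ℝ E ∧
      ∀ f ∈ Vᗮ, ∀ l : ℝ, 0 < l → ‖mehlerOp Ω (Real.exp (-l)) f‖ ≤
        2 ^ halfDim E * Real.exp 1 * Real.exp (-(r * l)) * ‖f‖ := by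
  have hr0 : 0 < r := zero_lt_one.trans_le hr
  have hν : Real.exp (-(1 / r)) ∈ Set.Ioo (0 : ℝ) 1 :=
    ⟨Real.exp_pos _, Real.exp_lt_one_iff.2 (neg_lt_zero.2 (by positivity))⟩
  obtain ⟨V, hfin, hdim, hV⟩ := (hilbertSchmidtBound_mehlerOp (E := E) hΩ
    hν).exists_norm_pow_apply_le (isSelfAdjoint_mehlerOp hΩ hν) (Real.exp_pos (-1))
  refine ⟨V, hfin, ?_, fun f hf l hl => norm_mehlerOp_exp_neg_le hΩ hr0 (fun j => hV j f hf) hl⟩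
  have hsub := one_sub_sq_pos hν
  calc (Module.finrank ℂ V : ℝ)
      = Real.exp 2 * (Module.finrank ℂ V * Real.exp (-1) ^ 2) := by
        rw [← Real.exp_nat_mul, mul_left_comm, ← Real.exp_add]
        norm_num
    _ ≤ Real.exp 2 * (2 * r) ^ Module.finrank ℝ E := by
        gcongr
        exact hdim.trans (pow_le_pow_left₀ (by positivity) (one_div_one_sub_exp_sq_le hr) _)

end Operators

section Trace

variable {E : Type*} [NormedAddCommGroup E] [InnerProductSpace ℝ E]

/-- The solution `m` of `(1 - m) / (1 + m) = (1 - n) / (2 (1 + n))`. For `n = exp (-2 ω t)`, the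
Mehler kernel of frequency `2 ω` at `m` then has the same Gaussian damping as the kernel of
`E_t* E_t`. -/
def comparisonParam (n : ℝ) : ℝ := (1 + 3 * n) / (3 + n)

variable {ω t n m : ℝ}

theorem comparisonParam_mem_Ioo (hn : n ∈ Set.Ioo (0 : ℝ) 1) :
    comparisonParam n ∈ Set.Ioo (0 : ℝ) 1 := by
  have hn0 := hn.1
  have hn1 := hn.2
  unfold comparisonParam
  exact ⟨by positivity, by rw [div_lt_one (by positivity)]; linarith⟩

theorem sqrt_mem_Ioo (hm : m ∈ Set.Ioo (0 : ℝ) 1) : √m ∈ Set.Ioo (0 : ℝ) 1 :=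
  ⟨Real.sqrt_pos.2 hm.1, by rw [Real.sqrt_lt' one_pos, one_pow]; exact hm.2⟩

theorem comparisonParam_damping (hn : 0 ≤ n) (ω : ℝ) :
    ω * (1 - comparisonParam n) / (1 + comparisonParam n) = ω * (1 - n) / (2 * (1 + n)) := by
  have hsub : 1 - comparisonParam n = 2 * (1 - n) / (3 + n) := by
    unfold comparisonParam
    field_simp
    ring
  have hadd : 1 + comparisonParam n = 4 * (1 + n) / (3 + n) := by
    unfold comparisonParam
    field_simp
    ring
  rw [hsub, hadd]
  field_simp
  ring

theorem comparisonParam_coupling (hn : n ∈ Set.Ioo (0 : ℝ) 1) (ω : ℝ) :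
    2 * ω * comparisonParam n / (1 - comparisonParam n ^ 2) =
      3 * ω * (1 + n) / (4 * (1 - n)) + ω * n / (1 - n ^ 2) := by
  have hn0 := hn.1
  have hsub : 0 < 1 - n := sub_pos.2 hn.2
  have hfac : 1 - n ^ 2 = (1 - n) * (1 + n) := by ring
  have hm : 1 - comparisonParam n ^ 2 = 8 * ((1 - n) * (1 + n)) / (3 + n) ^ 2 := by
    unfold comparisonParam
    field_simp
    ring
  rw [hm, hfac, comparisonParam]
  field_simp
  ring

theorem coupling_lt_comparisonParam_coupling (hω : 0 < ω) (ht : 0 < t)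
    (hn : n ∈ Set.Ioo (0 : ℝ) 1) (hnt : 1 - n ≤ 2 * ω * t) :
    1 / (4 * t) + ω * n / (1 - n ^ 2) <
      2 * ω * comparisonParam n / (1 - comparisonParam n ^ 2) := by
  have hn0 := hn.1
  have hsub : 0 < 1 - n := sub_pos.2 hn.2
  rw [comparisonParam_coupling hn, add_lt_add_iff_right, div_lt_div_iff₀ (by positivity)
    (by positivity)]
  nlinarith [mul_pos (mul_pos hω ht) hn0, mul_pos hω ht]

theorem comparison_const_le (hω : 0 < ω) (ht : 0 < t) (hn : n ∈ Set.Ioo (0 : ℝ) 1)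
    (hm : m ∈ Set.Ioo (0 : ℝ) 1) :
    1 / (4 * Real.pi * t) * (ω / (Real.pi * (1 - n ^ 2))) * (2 * ω * m / (1 - m ^ 2)) /
      (2 * ω / (Real.pi * (1 - m ^ 2)) * (1 / (4 * t) + ω * n / (1 - n ^ 2))) ≤
        ω / (Real.pi * (1 - n ^ 2)) := by
  have hn0 := hn.1
  have hm0 := hm.1
  have hsubn := one_sub_sq_pos hn
  have hsubm := one_sub_sq_pos hm
  set b := 1 / (4 * t) + ω * n / (1 - n ^ 2)
  have hb0 : 0 < b := by positivity
  have hbt : 1 / (4 * t) ≤ b := le_add_of_nonneg_right (by positivity)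
  calc _ = 1 / (4 * t) / b * m * (ω / (Real.pi * (1 - n ^ 2))) := by field_simp
    _ ≤ 1 * 1 * (ω / (Real.pi * (1 - n ^ 2))) := by
        gcongr
        · exact (div_le_one hb0).2 hbt
        · exact hm.2.le
    _ = ω / (Real.pi * (1 - n ^ 2)) := by rw [one_mul, one_mul]

theorem comparisonParam_exp_le (hω : 0 < ω) (ht : 0 < t) (ht1 : t ≤ 1) :
    comparisonParam (Real.exp (-ω * (2 * t))) ≤
      Real.exp (-(2 * (ω / (2 * (1 + 2 * ω)) * t))) := by
  have hn := exp_neg_mul_mem_Ioo hω (show 0 < 2 * t by positivity)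
  have hlow : 4 * (ω / (2 * (1 + 2 * ω)) * t) ≤ 1 - Real.exp (-ω * (2 * t)) := calc
    4 * (ω / (2 * (1 + 2 * ω)) * t) = 2 * ω * t / (1 + 2 * ω * 1) := by
      field_simp
      norm_num
    _ ≤ 2 * ω * t / (1 + 2 * ω * t) := by gcongr
    _ ≤ 1 - Real.exp (-(2 * ω * t)) := div_one_add_le_one_sub_exp_neg (by positivity)
    _ = 1 - Real.exp (-ω * (2 * t)) := by ring_nf
  refine le_trans ?_ (Real.add_one_le_exp _)
  generalize Real.exp (-ω * (2 * t)) = n at *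
  obtain ⟨hn0, hn1⟩ := hn
  rw [comparisonParam, div_le_iff₀ (by positivity)]
  nlinarith

theorem exists_sqrt_comparisonParam_eq_exp_neg (hω : 0 < ω) (ht : 0 < t) (ht1 : t ≤ 1) :
    ∃ l, ω / (2 * (1 + 2 * ω)) * t ≤ l ∧
      √(comparisonParam (Real.exp (-ω * (2 * t)))) = Real.exp (-l) := by
  have hm := comparisonParam_mem_Ioo (exp_neg_mul_mem_Ioo hω (show 0 < 2 * t by positivity))
  refine ⟨-Real.log √(comparisonParam (Real.exp (-ω * (2 * t)))), ?_, ?_⟩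
  · rw [Real.log_sqrt hm.1.le, le_neg, div_le_iff₀ two_pos]
    linarith [(Real.log_le_iff_le_exp hm.1).2 (comparisonParam_exp_le hω ht ht1)]
  · rw [neg_neg, Real.exp_log (Real.sqrt_pos.2 hm.1)]

theorem div_one_sub_exp_sq_le (hω : 0 < ω) (ht : 0 < t) :
    ω / (Real.pi * (1 - Real.exp (-ω * (2 * t)) ^ 2)) ≤ (1 + ω) * (1 / t + 1) := by
  have hexp : Real.exp (-ω * (2 * t)) ^ 2 = Real.exp (-(4 * ω * t)) := by
    rw [← Real.exp_nat_mul]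
    congr 1
    push_cast
    ring
  have hlow := div_one_add_le_one_sub_exp_neg (u := 4 * ω * t) (by positivity)
  have hωt : 0 < ω / t := by positivity
  rw [hexp]
  calc ω / (Real.pi * (1 - Real.exp (-(4 * ω * t))))
      ≤ ω / (1 * (4 * ω * t / (1 + 4 * ω * t))) := by
        gcongr
        linarith [Real.two_le_pi]
    _ = 1 / (4 * t) + ω := by field_simp
    _ ≤ 1 / t + ω := by
        gcongr
        linarith
    _ ≤ 1 / t + ω + (ω / t + 1) := by linarith
    _ = (1 + ω) * (1 / t + 1) := by
        field_simp
        ring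

theorem heatKernel_mul_mehlerKernel (ht : 0 < t) (hn : n ∈ Set.Ioo (0 : ℝ) 1) (z z' : E) :
    heatKernel (2 * t) z z' * mehlerKernel ω n z z' =
      gaussKernel (1 / (4 * Real.pi * t) * (ω / (Real.pi * (1 - n ^ 2))))
        (ω * (1 - n) / (2 * (1 + n)) + (1 / (4 * t) + ω * n / (1 - n ^ 2)))
        (ω * (1 - n) / (2 * (1 + n)) + (1 / (4 * t) + ω * n / (1 - n ^ 2)))
        (1 / (4 * t) + ω * n / (1 - n ^ 2)) z z' := by
  have hn0 := hn.1
  have hsub : 0 < 1 - n := sub_pos.2 hn.2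
  have hfac : 1 - n ^ 2 = (1 - n) * (1 + n) := by ring
  have hdiag : 1 / (2 * (2 * t)) + ω * (1 + n ^ 2) / (2 * (1 - n ^ 2)) =
      ω * (1 - n) / (2 * (1 + n)) + (1 / (4 * t) + ω * n / (1 - n ^ 2)) := by
    rw [hfac]
    field_simp
    ring
  have ht4 : 2 * (2 * t) = 4 * t := by ring
  have hpit : 2 * Real.pi * (2 * t) = 4 * Real.pi * t := by ring
  rw [heatKernel, mehlerKernel, gaussKernel_mul, hdiag, hpit, ht4]

variable [FiniteDimensional ℝ E] [MeasurableSpace E] [BorelSpace E]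

theorem integral_mehlerKernel_sqrt_mul (hω : 0 < ω) (hm : m ∈ Set.Ioo (0 : ℝ) 1) (x x' : E) :
    ∫ y, mehlerKernel (2 * ω) √m y x * mehlerKernel (2 * ω) √m y x' =
      gaussKernel (2 * ω / (Real.pi * (1 - m ^ 2)))
        (ω * (1 - m) / (1 + m) + 2 * ω * m / (1 - m ^ 2))
        (ω * (1 - m) / (1 + m) + 2 * ω * m / (1 - m ^ 2)) (2 * ω * m / (1 - m ^ 2)) x x' := by
  have hm0 := hm.1
  have hsub : 0 < 1 - m := sub_pos.2 hm.2
  have hfac : 1 - m ^ 2 = (1 - m) * (1 + m) := by ring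
  have hdiag : 2 * ω * (1 + m ^ 2) / (2 * (1 - m ^ 2)) =
      ω * (1 - m) / (1 + m) + 2 * ω * m / (1 - m ^ 2) := by
    rw [hfac]
    field_simp
    ring
  simp only [mehlerKernel_swap _ _ x]
  rw [integral_mehlerKernel_mul (by positivity) (sqrt_mem_Ioo hm) (sqrt_mem_Ioo hm),
    Real.mul_self_sqrt hm0.le, mehlerKernel, hdiag]

theorem integral_traceKernel_mul_eq_gaussKernel (hω : 0 < ω) (ht : 0 < t)
    (hn : n = Real.exp (-ω * (2 * t))) (z z' : E) :
    ∫ X, traceKernel ω t X z * traceKernel ω t X z' =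
      gaussKernel (1 / (4 * Real.pi * t) * (ω / (Real.pi * (1 - n ^ 2))))
        (ω * (1 - n) / (2 * (1 + n)) + (1 / (4 * t) + ω * n / (1 - n ^ 2)))
        (ω * (1 - n) / (2 * (1 + n)) + (1 / (4 * t) + ω * n / (1 - n ^ 2)))
        (1 / (4 * t) + ω * n / (1 - n ^ 2)) z z' := by
  rw [integral_traceKernel_mul hω ht, ← hn, heatKernel_mul_mehlerKernel ht
    (hn ▸ exp_neg_mul_mem_Ioo hω (by positivity))]

theorem lintegral_traceKernel_mul (hω : 0 < ω) (ht : 0 < t) (hn : n = Real.exp (-ω * (2 * t)))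
    (z z' : E) :
    ∫⁻ X, ENNReal.ofReal (traceKernel ω t X z) * ENNReal.ofReal (traceKernel ω t X z') =
      ENNReal.ofReal (gaussKernel (1 / (4 * Real.pi * t) * (ω / (Real.pi * (1 - n ^ 2))))
        (ω * (1 - n) / (2 * (1 + n)) + (1 / (4 * t) + ω * n / (1 - n ^ 2)))
        (ω * (1 - n) / (2 * (1 + n)) + (1 / (4 * t) + ω * n / (1 - n ^ 2)))
        (1 / (4 * t) + ω * n / (1 - n ^ 2)) z z') := by
  have hn' : n ∈ Set.Ioo (0 : ℝ) 1 := hn ▸ exp_neg_mul_mem_Ioo hω (by positivity)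
  have hsub := one_sub_sq_pos hn'
  have hnonneg : ∀ X : E × E, 0 ≤ traceKernel ω t X z := fun X => evolutionKernel_nonneg _ _ _ _
  have hint : Integrable fun X : E × E => traceKernel ω t X z * traceKernel ω t X z' := by
    refine .of_integral_ne_zero (ne_of_gt ?_)
    rw [integral_traceKernel_mul_eq_gaussKernel hω ht hn]
    unfold gaussKernel
    positivity
  simp only [← ENNReal.ofReal_mul (hnonneg _)]
  rw [← ofReal_integral_eq_lintegral_ofReal hint (.of_forall fun X =>
    mul_nonneg (hnonneg X) (evolutionKernel_nonneg _ _ _ _)),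
    integral_traceKernel_mul_eq_gaussKernel hω ht hn]

theorem lintegral_lintegral_traceKernel_mul_le (hω : 0 < ω) (ht : 0 < t) (z : E) :
    ∫⁻ z', ∫⁻ X, ENNReal.ofReal (traceKernel ω t X z) * ENNReal.ofReal (traceKernel ω t X z') ≤
      ENNReal.ofReal (((1 + ω) * (1 / t + 1)) ^ halfDim E) := by
  obtain ⟨n, hn⟩ : ∃ n, n = Real.exp (-ω * (2 * t)) := ⟨_, rfl⟩
  have hn' : n ∈ Set.Ioo (0 : ℝ) 1 := hn ▸ exp_neg_mul_mem_Ioo hω (by positivity)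
  have hn0 := hn'.1
  have hsub : 0 < 1 - n := sub_pos.2 hn'.2
  have hsub2 := one_sub_sq_pos hn'
  set a := ω * (1 - n) / (2 * (1 + n)) with ha
  set b := 1 / (4 * t) + ω * n / (1 - n ^ 2) with hb
  have ha0 : 0 ≤ a := by positivity
  have hb0 : 0 < b := by positivity
  have hab : 1 / (4 * t) ≤ a + b := by
    linarith [show (0 : ℝ) ≤ ω * n / (1 - n ^ 2) by positivity]
  simp only [lintegral_traceKernel_mul hω ht hn, ← ha, ← hb]
  refine (lintegral_gaussKernel_le (by positivity) (by nlinarith) z).trans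
    (ENNReal.ofReal_le_ofReal ?_)
  rw [abs_of_pos (by positivity)]
  refine Real.rpow_le_rpow (by positivity) ?_ (by positivity)
  calc 1 / (4 * Real.pi * t) * (ω / (Real.pi * (1 - n ^ 2))) * (Real.pi / (a + b))
      ≤ 1 / (4 * Real.pi * t) * (ω / (Real.pi * (1 - n ^ 2))) * (Real.pi / (1 / (4 * t))) := by
        gcongr
    _ = ω / (Real.pi * (1 - n ^ 2)) := by field_simp
    _ ≤ (1 + ω) * (1 / t + 1) := hn ▸ div_one_sub_exp_sq_le hω ht

theorem isBoundedKernel_traceKernel (hω : 0 < ω) (ht : 0 < t) :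
    IsBoundedKernel volume volume (traceKernel ω t : E × E → E → ℝ)
      (((1 + ω) * (1 / t + 1)) ^ (halfDim E / 2)) := by
  have hmeas : Measurable fun z : (E × E) × E => traceKernel ω t z.1 z.2 :=
    ((measurable_traceKernel (E := E) ω).comp
      ((measurable_const (a := t)).prodMk measurable_id) :)
  refine ⟨hmeas, fun X z => evolutionKernel_nonneg _ _ _ _,
    kernelBound_of_schur_sq hmeas.ennreal_ofReal fun z => ?_⟩
  rw [← ENNReal.ofReal_pow (by positivity), ← Real.rpow_mul_natCast (by positivity),
    Nat.cast_ofNat, div_mul_cancel₀ _ two_ne_zero]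
  exact lintegral_lintegral_traceKernel_mul_le hω ht z

/-- The operator `E_t : L²(E) → L²(E × E)`, the semigroup `exp (-t H₀)` applied to measures on the
plane `x = y` with a square integrable density. -/
def traceOp (ω t : ℝ) :
    Lp ℂ 2 (volume : Measure E) →L[ℂ] Lp ℂ 2 (volume : Measure (E × E)) :=
  integralOperator volume volume (traceKernel ω t)

theorem isIntegralOperator_traceOp (hω : 0 < ω) (ht : 0 < t) :
    IsIntegralOperator (traceOp (E := E) ω t) (traceKernel ω t) :=
  (isBoundedKernel_traceKernel hω ht).isIntegralOperator (by positivity)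

theorem isIntegralOperator_evolutionOp (hω : 0 < ω) (ht : 0 < t) :
    IsIntegralOperator (evolutionOp (E := E) ω t) (evolutionKernel ω t) :=
  (isBoundedKernel_evolutionKernel hω ht).isIntegralOperator (by positivity)

theorem norm_evolutionOp_le (hω : 0 < ω) (ht : 0 < t) :
    ‖evolutionOp (E := E) ω t‖ ≤ 2 ^ halfDim E :=
  (isBoundedKernel_evolutionKernel hω ht).norm_integralOperator_le (by positivity)

theorem evolutionOp_traceOp {s : ℝ} (hω : 0 < ω) (hs : 0 < s) (ht : 0 < t)
    (f : Lp ℂ 2 (volume : Measure E)) :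
    evolutionOp ω s (traceOp ω t f) = traceOp ω (s + t) f := by
  have hcomp := (isIntegralOperator_traceOp (E := E) hω ht).comp
    (isBoundedKernel_traceKernel hω ht) (isIntegralOperator_evolutionOp hω hs)
    (isBoundedKernel_evolutionKernel hω hs)
  simp only [traceKernel, integral_evolutionKernel_mul hω hs ht] at hcomp
  rw [← ContinuousLinearMap.comp_apply,
    hcomp.unique (isIntegralOperator_traceOp hω (add_pos hs ht))]

theorem norm_traceOp_le (hω : 0 < ω) (ht : 0 < t) (f : Lp ℂ 2 (volume : Measure E)) :
    ‖traceOp ω t f‖ ≤ ((1 + ω) * (1 / t + 1)) ^ (halfDim E / 2) *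
      ‖mehlerOp (2 * ω) √(comparisonParam (Real.exp (-ω * (2 * t)))) f‖ := by
  obtain ⟨n, hn⟩ : ∃ n, n = Real.exp (-ω * (2 * t)) := ⟨_, rfl⟩
  have hn' : n ∈ Set.Ioo (0 : ℝ) 1 := hn ▸ exp_neg_mul_mem_Ioo hω (by positivity)
  have hm := comparisonParam_mem_Ioo hn'
  have hn0 := hn'.1
  have hsub : 0 < 1 - n := sub_pos.2 hn'.2
  have hsubn := one_sub_sq_pos hn'
  have hsubm := one_sub_sq_pos hm
  have hnt : 1 - n ≤ 2 * ω * t := by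
    rw [hn]
    linarith [Real.add_one_le_exp (-ω * (2 * t))]
  have hω2 : 0 < 2 * ω := by positivity
  have hκ : 0 < 1 / (4 * Real.pi * t) * (ω / (Real.pi * (1 - n ^ 2))) := by positivity
  have hM := integral_mehlerKernel_sqrt_mul (E := E) hω hm
  rw [comparisonParam_damping hn0.le] at hM
  have hsq := norm_sq_le_of_gaussKernel (by positivity) (by positivity)
    (coupling_lt_comparisonParam_coupling hω ht hn' hnt) hκ (by positivity)
    (isIntegralOperator_traceOp hω ht) (isBoundedKernel_traceKernel hω ht)
    (integral_traceKernel_mul_eq_gaussKernel hω ht hn)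
    (isIntegralOperator_mehlerOp hω2 (sqrt_mem_Ioo hm))
    (isBoundedKernel_mehlerKernel hω2 (sqrt_mem_Ioo hm)) hM f
  have hm0 := hm.1
  rw [← hn]
  refine le_of_sq_le_sq (hsq.trans ?_) (by positivity)
  rw [mul_pow, ← Real.rpow_mul_natCast (by positivity), Nat.cast_ofNat,
    div_mul_cancel₀ _ two_ne_zero]
  refine mul_le_mul_of_nonneg_right (Real.rpow_le_rpow (by positivity) ?_ (by positivity))
    (sq_nonneg _)
  exact (comparison_const_le hω ht hn' hm).trans (hn ▸ div_one_sub_exp_sq_le hω ht)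

theorem norm_traceOp_le_of_le_one (hω : 0 < ω) {A r : ℝ} (hA : 0 ≤ A) (hr : 0 ≤ r)
    {f : Lp ℂ 2 (volume : Measure E)}
    (hf : ∀ l, 0 < l → ‖mehlerOp (2 * ω) (Real.exp (-l)) f‖ ≤ A * Real.exp (-(r * l)) * ‖f‖)
    (ht : 0 < t) (ht1 : t ≤ 1) :
    ‖traceOp ω t f‖ ≤ (2 * (1 + ω)) ^ (halfDim E / 2) * A *
      (t ^ (-(halfDim E / 2)) * Real.exp (-(ω / (2 * (1 + 2 * ω)) * r) * t)) * ‖f‖ := by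
  set c := ω / (2 * (1 + 2 * ω))
  have hct : 0 < c * t := by positivity
  obtain ⟨l, hl, hexp⟩ := exists_sqrt_comparisonParam_eq_exp_neg hω ht ht1
  have hbase : (1 + ω) * (1 / t + 1) ≤ 2 * (1 + ω) * t⁻¹ := by
    have hone : 1 ≤ t⁻¹ := (one_le_inv₀ ht).2 ht1
    rw [one_div]
    nlinarith
  calc ‖traceOp ω t f‖
      ≤ ((1 + ω) * (1 / t + 1)) ^ (halfDim E / 2) * ‖mehlerOp (2 * ω) (Real.exp (-l)) f‖ :=
        hexp ▸ norm_traceOp_le hω ht f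
    _ ≤ (2 * (1 + ω) * t⁻¹) ^ (halfDim E / 2) * (A * Real.exp (-(r * (c * t))) * ‖f‖) := by
        gcongr
        exact (hf l (hct.trans_le hl)).trans (by gcongr)
    _ = (2 * (1 + ω)) ^ (halfDim E / 2) * A *
          (t ^ (-(halfDim E / 2)) * Real.exp (-(c * r) * t)) * ‖f‖ := by
        rw [Real.mul_rpow (by positivity) (by positivity), Real.inv_rpow ht.le,
          ← Real.rpow_neg ht.le, neg_mul, mul_left_comm r, ← mul_assoc c]
        ring

theorem exists_submodule_traceOp (hω : 0 < ω) {r : ℝ} (hr : 1 ≤ r) :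
    ∃ V : Submodule ℂ (Lp ℂ 2 (volume : Measure E)), FiniteDimensional ℂ V ∧
      Module.finrank ℂ V ≤ Real.exp 2 * (2 * r) ^ Module.finrank ℝ E ∧
      ∀ f ∈ Vᗮ, ∀ t, 0 < t → ‖traceOp ω t f‖ ≤
        2 ^ halfDim E * ((2 * (1 + ω)) ^ (halfDim E / 2) * (2 ^ halfDim E * Real.exp 1)) *
          (t ^ (-(halfDim E / 2)) * Real.exp (-(ω / (2 * (1 + 2 * ω)) * r) * t) +
            Real.exp (-(ω / (2 * (1 + 2 * ω)) * r))) * ‖f‖ := by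
  obtain ⟨V, hfin, hdim, hV⟩ := exists_submodule_mehlerOp (E := E) (Ω := 2 * ω) (by positivity) hr
  refine ⟨V, hfin, hdim, fun f hf t ht => ?_⟩
  have hsmall := fun s hs hs1 => norm_traceOp_le_of_le_one (t := s) hω (by positivity)
    (zero_le_one.trans hr) (hV f hf) hs hs1
  set A := (2 * (1 + ω)) ^ (halfDim E / 2) * (2 ^ halfDim E * Real.exp 1)
  set c := ω / (2 * (1 + 2 * ω))
  have hA0 : 0 ≤ A := by positivity
  rcases le_or_gt t 1 with ht1 | ht1
  · refine (hsmall t ht ht1).trans ?_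
    gcongr
    · exact le_mul_of_one_le_left hA0 (Real.one_le_rpow one_le_two (by positivity))
    · exact le_add_of_nonneg_right (Real.exp_pos _).le
  · have hsplit : traceOp ω t f = evolutionOp ω (t - 1) (traceOp ω 1 f) := by
      rw [evolutionOp_traceOp hω (sub_pos.2 ht1) one_pos, sub_add_cancel]
    have hone := hsmall 1 one_pos le_rfl
    rw [Real.one_rpow, one_mul, mul_one] at hone
    calc ‖traceOp ω t f‖ ≤ 2 ^ halfDim E * ‖traceOp ω 1 f‖ := hsplit ▸
          ContinuousLinearMap.le_of_opNorm_le _ (norm_evolutionOp_le hω (sub_pos.2 ht1)) _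
      _ ≤ 2 ^ halfDim E * (A * Real.exp (-(c * r)) * ‖f‖) := by gcongr
      _ = 2 ^ halfDim E * A * Real.exp (-(c * r)) * ‖f‖ := by ring
      _ ≤ _ := by
          gcongr
          exact le_add_of_nonneg_left (by positivity)

end Trace

section Laplace

variable {E : Type*} [NormedAddCommGroup E] [InnerProductSpace ℝ E] [FiniteDimensional ℝ E]
  [MeasurableSpace E] [BorelSpace E] {ω lam : ℝ}

theorem exists_laplace_evolutionOp (hω : 0 < ω) (hlam : 0 < lam) :
    ∃ G : Lp ℂ 2 (volume : Measure (E × E)) →L[ℂ] Lp ℂ 2 (volume : Measure (E × E)),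
      IsIntegralOperator G (fun X X' => ∫ t in Set.Ioi (0 : ℝ),
        Real.exp (-lam * t) * evolutionKernel ω t X X') ∧
      IsWeakLaplaceTransform lam (evolutionOp ω) G :=
  exists_laplace_isIntegralOperator (measurable_evolutionKernel ω)
    (fun _ ht => isIntegralOperator_evolutionOp hω ht) measurable_const (fun _ => by positivity)
    (fun _ ht => isBoundedKernel_evolutionKernel hω ht)
    ((integrableOn_exp_neg_mul hlam).mul_const (2 ^ halfDim E))

theorem rpow_one_div_add_one_le {A t β : ℝ} (hA : 0 ≤ A) (ht : 0 < t) (hβ : 0 ≤ β)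
    (hβ1 : β ≤ 1) : (A * (1 / t + 1)) ^ β ≤ A ^ β * (t ^ (-β) + 1) := by
  rw [Real.mul_rpow hA (by positivity)]
  gcongr
  calc (1 / t + 1) ^ β ≤ (1 / t) ^ β + 1 ^ β :=
        Real.rpow_add_le_add_rpow (by positivity) zero_le_one hβ hβ1
    _ = t ^ (-β) + 1 := by rw [one_div, Real.inv_rpow ht.le, Real.rpow_neg ht.le, Real.one_rpow]

theorem exists_laplace_traceOp (hE : halfDim E < 2) (hω : 0 < ω) (hlam : 0 < lam) :
    ∃ P : Lp ℂ 2 (volume : Measure E) →L[ℂ] Lp ℂ 2 (volume : Measure (E × E)),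
      IsIntegralOperator P (fun X z => ∫ t in Set.Ioi (0 : ℝ),
        Real.exp (-lam * t) * traceKernel ω t X z) ∧
      IsWeakLaplaceTransform lam (traceOp ω) P := by
  have hβ : halfDim E / 2 < 1 := by linarith
  refine exists_laplace_isIntegralOperator (measurable_traceKernel ω)
    (fun t ht => isIntegralOperator_traceOp hω ht)
    (c := fun t => (1 + ω) ^ (halfDim E / 2) * (|t| ^ (-(halfDim E / 2)) + 1))
    (by fun_prop) (fun _ => by positivity)
    (fun t ht => (isBoundedKernel_traceKernel hω ht).mono_right ?_) ?_
  · rw [abs_of_pos ht]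
    exact rpow_one_div_add_one_le (by positivity) ht (by positivity) hβ.le
  · refine IntegrableOn.congr_fun (((integrableOn_rpow_neg_mul_exp_neg_mul hβ hlam).add
      (integrableOn_exp_neg_mul hlam)).const_mul ((1 + ω) ^ (halfDim E / 2))) (fun t ht => ?_)
      measurableSet_Ioi
    simp only [Pi.add_apply, abs_of_pos (Set.mem_Ioi.1 ht)]
    ring

theorem isSchatten_of_laplace_traceOp [Nontrivial E] (hE : halfDim E < 2) (hω : 0 < ω)
    (hlam : 0 < lam)
    {G : Lp ℂ 2 (volume : Measure (E × E)) →L[ℂ] Lp ℂ 2 (volume : Measure (E × E))}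
    {P : Lp ℂ 2 (volume : Measure E) →L[ℂ] Lp ℂ 2 (volume : Measure (E × E))}
    (hG : IsWeakLaplaceTransform lam (evolutionOp ω) G)
    (hP : IsWeakLaplaceTransform lam (traceOp ω) P) (k : ℕ) {p : ℝ}
    (hp : Module.finrank ℝ E / (k + 2 * (1 - halfDim E / 2)) < p) :
    IsSchatten p (P.adjoint ∘L (G ^ k) ∘L P) := by
  refine isSchatten_adjoint_comp_pow_comp hlam hG hP
    (fun s t hs ht f => evolutionOp_traceOp hω hs ht f) (by positivity) (by linarith)
    (show 0 < ω / (2 * (1 + 2 * ω)) by positivity)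
    (C := 2 ^ halfDim E * ((2 * (1 + ω)) ^ (halfDim E / 2) * (2 ^ halfDim E * Real.exp 1)))
    (by positivity) (show 0 < Real.exp 2 * 2 ^ Module.finrank ℝ E by positivity)
    (Nat.cast_pos.2 Module.finrank_pos) (fun r hr => ?_) k hp
  obtain ⟨V, hfin, hdim, hV⟩ := exists_submodule_traceOp (E := E) hω hr
  refine ⟨V, hfin, hdim.trans_eq ?_, hV⟩
  rw [Real.rpow_natCast, mul_pow, mul_assoc]

end Laplace

end ZeroRange

end

theorem mainTheorem12_general (ω : ℝ) (hω : 0 < ω) (k : ℕ) (lam : ℝ) (hlam : 0 < lam) :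
    ∃ (G : ZeroRange.L2R6 →L[ℂ] ZeroRange.L2R6) (P : ZeroRange.L2R3 →L[ℂ] ZeroRange.L2R6),
      ZeroRange.IsIntegralOperator G (ZeroRange.greenKernel ω lam) ∧
      ZeroRange.IsIntegralOperator P (ZeroRange.potentialKernel ω lam) ∧
      ∀ p : ℝ, 3 / ((k : ℝ) + 1 / 2) < p →
        ZeroRange.IsSchatten p (P.adjoint ∘L (G ^ k) ∘L P) := by
  have hdim : ZeroRange.halfDim ZeroRange.R3 < 2 := by rw [ZeroRange.halfDim_R3]; norm_num
  obtain ⟨G, hG, hGlap⟩ := ZeroRange.exists_laplace_evolutionOp (E := ZeroRange.R3) hω hlam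
  obtain ⟨P, hP, hPlap⟩ := ZeroRange.exists_laplace_traceOp hdim hω hlam
  have hgreen : ZeroRange.greenKernel ω lam = fun X X' => ∫ t in Set.Ioi (0 : ℝ),
      Real.exp (-lam * t) * ZeroRange.evolutionKernel ω t X X' :=
    funext₂ fun X X' => ZeroRange.greenKernel_eq hω lam X X'
  have hpotential : ZeroRange.potentialKernel ω lam = fun X z => ∫ t in Set.Ioi (0 : ℝ),
      Real.exp (-lam * t) * ZeroRange.traceKernel ω t X z :=
    funext₂ fun X z => ZeroRange.greenKernel_eq hω lam X (z, z)
  refine ⟨G, P, hgreen ▸ hG, hpotential ▸ hP, fun p hp =>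
    ZeroRange.isSchatten_of_laplace_traceOp hdim hω hlam hGlap hPlap k (lt_of_eq_of_lt ?_ hp)⟩
  rw [ZeroRange.halfDim_R3, finrank_euclideanSpace_fin]
  norm_num

theorem mainTheorem12 (ω : ℝ) (hω : 0 < ω) (k : ℕ) (lam : ℝ) (hlam : (k : ℝ) < lam) :
    ∃ (G : ZeroRange.L2R6 →L[ℂ] ZeroRange.L2R6) (P : ZeroRange.L2R3 →L[ℂ] ZeroRange.L2R6),
      ZeroRange.IsIntegralOperator G (ZeroRange.greenKernel ω lam) ∧
      ZeroRange.IsIntegralOperator P (ZeroRange.potentialKernel ω lam) ∧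
      ∀ p : ℝ, 3 / ((k : ℝ) + 1 / 2) < p →
        ZeroRange.IsSchatten p (P.adjoint ∘L (G ^ k) ∘L P) :=
  mainTheorem12_general ω hω k lam (k.cast_nonneg.trans_lt hlam)
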